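/- Let $L>0$, $T>0$, $\alpha\in\mathbb{R}\setminus\{0\}$, $s\ge 1$, $\chi>0$, and let $\mathbb{T}=[-L,L]$ be the one-dimensional torus (periodic boundary conditions), with $H^s=H^s(\mathbb{T})$ normed by $\|f\|_{H^s}^2=\sum_{l\in\mathbb{Z}}(1+(\pi l/L)^2)^s|\hat f_l|^2$. Put $U=[-\frac12,\frac12]^{\mathbb{N}}$ and $U_m=[-\frac12,\frac12]^m$. Let $\lambda_1>\lambda_2>\cdots>0$, let $v_0,v_1,v_2,\dots$ be real-valued continuous functions on $\mathbb{T}$, and consider the potentials $$V(\xi,x)=v_0(x)+\sum_{j=1}^{\infty}\sqrt{\lambda_j}\,\xi_j v_j(x)\quad(\xi\in U),\qquad V_m(\xi,x)=v_0(x)+\sum_{j=1}^{m}\sqrt{\lambda_j}\,\xi_j v_j(x)\quad(\xi\in U_m),$$ where $V_m$ is also regarded as a function on $U$ through the first $m$ components of $\xi$. For functions $W$ on $U$ write $\|W\|_{L^\infty(U;H^r)}=\sup_{\xi\in U}\|W(\xi)\|_{H^r}$. Assume: 1. $G\in (H^1(\mathbb{T}))'$ is a bounded linear functional, $\psi_{in}\in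 H^s(\mathbb{T})$, $V\in L^\infty(U;H^s)$, and $\|V_m\|_{L^\infty(U;H^s)}\le\|V\|_{L^\infty(U;H^s)}$ for all $m\ge1$; 2. $\|V_m-V\|_{L^\infty(U;H^1)}\le C_0 m^{-\chi}$ for all $m\ge 1$ with some constant $C_0>0$, and $\sum_{j\ge1}\big[3^j\sqrt{\lambda_j}\,\|v_j\|_{H^1}\big]^{1/2}<\infty$. For $\xi\in U$ let $\psi(\cdot,\xi,\cdot)\in C([0,T];H^1(\mathbb{T}))$ be the (mild) solution of $$i\partial_t\psi=-\tfrac12\partial_x^2\psi+V(\xi,x)\psi+\alpha|\psi|^2\psi,\qquad \psi(0,\xi,x)=\psi_{in}(x),$$ and for $m\ge1$, $\xi\in U_m$ let $\psi_m(\cdot,\xi,\cdot)\in C([0,T];H^1(\mathbb{T}))$ be the (mild) solution of the same problem with $V_m$ in place of $V$. Put $\mathcal{G}(t,\xi)=G(|\psi(t,\xi,\cdot)|^2)$ and $\mathcal{G}^m(t,\xi)=G(|\psi_m(t,\xi,\cdot)|^2)$, and $\mathbb{E}_m[\mathcal{G}^m](t)=\int_{U_m}\mathcal{G}^m(t,\xi)\,d\xi$.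 Then there is a constant $C$, independent of $m$ and $t$, such that for every $t\in[0,T]$: the functions $\mathcal{G}(t,\cdot)$ (with respect to the product of the uniform laws on $U$) and $\mathcal{G}^m(t,\cdot)$, $m\ge1$, are integrable; the limit $$\mathbb{E}[\mathcal{G}](t)=\lim_{p\to\infty}\int_{U_p}\mathcal{G}^p(t,\xi)\,d\xi$$ exists and equals the expectation of $\mathcal{G}(t,\cdot)$ under the product of the uniform laws on $U$; and $$\big|\mathbb{E}[\mathcal{G}](t)-\mathbb{E}_m[\mathcal{G}^m](t)\big|\le C\,m^{-\chi}\qquad\text{for all } m\ge1.$$ -/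

import Mathlib

open MeasureTheory Filter Topology
open scoped ENNReal NNReal

noncomputable section

/-- The torus `[-L, L]` with periodic boundary conditions. -/
abbrev Torus (L : ℝ) : Type := AddCircle (2 * L)

/-- The angular frequency `π l / L` of the `l`-th Fourier mode on the torus of length `2 L`. -/
def freq (L : ℝ) (l : ℤ) : ℝ := Real.pi * l / L

section Sobolev

variable {L : ℝ} [Fact (0 < 2 * L)]

/-- The `H^s` norm on the torus,
`‖f‖_{H^s} = (∑_l (1 + (π l / L)^2)^s |f̂_l|^2)^{1/2}`, with value `∞` if `f` is not in `H^s`. -/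
def sobolevNorm (s : ℝ) (f : C(Torus L, ℂ)) : ℝ≥0∞ :=
  (∑' l : ℤ, ENNReal.ofReal ((1 + freq L l ^ 2) ^ s) * ‖fourierCoeff f l‖ₑ ^ 2) ^ (1 / 2 : ℝ)

theorem sobolevNorm_lt_top_iff {s : ℝ} {f : C(Torus L, ℂ)} :
    sobolevNorm s f < ⊤ ↔
      ∑' l : ℤ, ENNReal.ofReal ((1 + freq L l ^ 2) ^ s) * ‖fourierCoeff f l‖ₑ ^ 2 < ⊤ := by
  unfold sobolevNorm
  exact ENNReal.rpow_lt_top_iff_of_pos (by norm_num)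

theorem fourierCoeff_add_cont (f g : C(Torus L, ℂ)) (l : ℤ) :
    fourierCoeff (f + g : C(Torus L, ℂ)) l = fourierCoeff f l + fourierCoeff g l := by
  have hf : Integrable (f : Torus L → ℂ) AddCircle.haarAddCircle :=
    f.continuous.integrable_of_hasCompactSupport (HasCompactSupport.of_compactSpace _)
  have hg : Integrable (g : Torus L → ℂ) AddCircle.haarAddCircle :=
    g.continuous.integrable_of_hasCompactSupport (HasCompactSupport.of_compactSpace _)
  simpa using congrFun (fourierCoeff.add hf hg) l

/-- The Sobolev space `H^s` of complex valued functions on the torus, for `s > 1/2` (only `s ≥ 1`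
is used): by the Sobolev embedding each of its elements has exactly one continuous
representative, so it is realized as a space of continuous functions. -/
def Hs (L : ℝ) [Fact (0 < 2 * L)] (s : ℝ) : Submodule ℂ C(Torus L, ℂ) where
  carrier := {f | sobolevNorm s f < ⊤}
  zero_mem' := by
    have : ∀ l : ℤ, fourierCoeff ((0 : C(Torus L, ℂ)) : Torus L → ℂ) l = 0 := fun l => by
      simp [fourierCoeff]
    simp only [Set.mem_ofPred_eq, sobolevNorm_lt_top_iff, this]
    simp
  add_mem' := by
    intro f g hf hg
    simp only [Set.mem_ofPred_eq, sobolevNorm_lt_top_iff] at hf hg ⊢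
    have key : ∀ l : ℤ, ENNReal.ofReal ((1 + freq L l ^ 2) ^ s) *
        ‖fourierCoeff (f + g : C(Torus L, ℂ)) l‖ₑ ^ 2 ≤
        2 * (ENNReal.ofReal ((1 + freq L l ^ 2) ^ s) * ‖fourierCoeff f l‖ₑ ^ 2) +
        2 * (ENNReal.ofReal ((1 + freq L l ^ 2) ^ s) * ‖fourierCoeff g l‖ₑ ^ 2) := by
      intro l
      have h : ‖fourierCoeff (f + g : C(Torus L, ℂ)) l‖ₑ ^ 2 ≤
          2 * ‖fourierCoeff f l‖ₑ ^ 2 + 2 * ‖fourierCoeff g l‖ₑ ^ 2 := by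
        rw [fourierCoeff_add_cont]
        simp only [enorm_eq_nnnorm]
        norm_cast
        have h1 := norm_add_le (fourierCoeff f l) (fourierCoeff g l)
        rw [← NNReal.coe_le_coe]
        push_cast
        nlinarith [norm_nonneg (fourierCoeff f l + fourierCoeff g l),
          sq_nonneg (‖fourierCoeff f l‖ - ‖fourierCoeff g l‖)]
      calc _ ≤ ENNReal.ofReal ((1 + freq L l ^ 2) ^ s) *
            (2 * ‖fourierCoeff f l‖ₑ ^ 2 + 2 * ‖fourierCoeff g l‖ₑ ^ 2) := by gcongr
        _ = _ := by ring
    refine (ENNReal.tsum_le_tsum key).trans_lt ?_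
    rw [ENNReal.tsum_add, ENNReal.tsum_mul_left, ENNReal.tsum_mul_left]
    exact ENNReal.add_lt_top.2
      ⟨ENNReal.mul_lt_top (by simp) hf, ENNReal.mul_lt_top (by simp) hg⟩
  smul_mem' := by
    intro c f hf
    simp only [Set.mem_ofPred_eq, sobolevNorm_lt_top_iff] at hf ⊢
    have key : ∀ l : ℤ, ENNReal.ofReal ((1 + freq L l ^ 2) ^ s) *
        ‖fourierCoeff (c • f : C(Torus L, ℂ)) l‖ₑ ^ 2 =
        ‖c‖ₑ ^ 2 * (ENNReal.ofReal ((1 + freq L l ^ 2) ^ s) * ‖fourierCoeff f l‖ₑ ^ 2) := by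
      intro l
      have : fourierCoeff (c • f : C(Torus L, ℂ)) l = c * fourierCoeff f l := by
        simpa using fourierCoeff.const_smul (f : Torus L → ℂ) c l
      rw [this, enorm_mul]
      ring
    simp only [key]
    rw [ENNReal.tsum_mul_left]
    exact ENNReal.mul_lt_top (by simp) hf

/-- The continuous function `|f|^2`. -/
def absSq (f : C(Torus L, ℂ)) : C(Torus L, ℂ) where
  toFun x := ((‖f x‖ ^ 2 : ℝ) : ℂ)
  continuous_toFun := by fun_prop

theorem hasSum_sq_fourierCoeff_cont (f : C(Torus L, ℂ)) :
    HasSum (fun l => ‖fourierCoeff f l‖ ^ 2)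
      (∫ x, ‖f x‖ ^ 2 ∂(AddCircle.haarAddCircle : Measure (Torus L))) := by
  have h := hasSum_sq_fourierCoeff
    (ContinuousMap.toLp (E := ℂ) 2 (AddCircle.haarAddCircle : Measure (Torus L)) ℂ f)
  simp only [fourierCoeff_toLp] at h
  convert h using 1
  refine integral_congr_ae ?_
  filter_upwards [ContinuousMap.coeFn_toLp (p := 2) (𝕜 := ℂ)
    (AddCircle.haarAddCircle : Measure (Torus L)) f] with x hx
  rw [hx]

/-- The increment `f(x + h) - f(x)`. -/
def increment (h : ℝ) (f : C(Torus L, ℂ)) : C(Torus L, ℂ) where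
  toFun x := f (x + (h : Torus L)) - f x
  continuous_toFun := by fun_prop

theorem fourierCoeff_increment (h : ℝ) (f : C(Torus L, ℂ)) (l : ℤ) :
    fourierCoeff (increment h f) l =
      (fourier l (h : Torus L) - 1) * fourierCoeff f l := by
  have hi : ∀ g : C(Torus L, ℂ), Integrable (g : Torus L → ℂ) AddCircle.haarAddCircle := fun g =>
    g.continuous.integrable_of_hasCompactSupport (HasCompactSupport.of_compactSpace _)
  have h1 : fourierCoeff (fun x => f (x + (h : Torus L))) l
      = fourier l (h : Torus L) * fourierCoeff f l := by
    unfold fourierCoeff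
    rw [← integral_add_right_eq_self (μ := (AddCircle.haarAddCircle : Measure (Torus L)))
      (fun t => fourier (-l) t • f t) (h : Torus L), ← integral_const_mul]
    refine integral_congr_ae (Eventually.of_forall fun x => ?_)
    simp only [smul_eq_mul]
    have e1 : (fourier (-l) (x + (h : Torus L)) : ℂ) =
        fourier (-l) x * fourier (-l) (h : Torus L) := by
      simp [fourier_apply, AddCircle.toCircle_add]
    have e2 : (fourier l (h : Torus L) : ℂ) * fourier (-l) (h : Torus L) = 1 := by
      rw [← fourier_add]; simp
    rw [e1]
    linear_combination (-(fourier (-l) x * f (x + (h : Torus L)))) * e2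
  have h2 : fourierCoeff (increment h f) l =
      fourierCoeff (fun x => f (x + (h : Torus L))) l - fourierCoeff f l := by
    unfold fourierCoeff
    rw [← integral_sub]
    · refine integral_congr_ae (Eventually.of_forall fun x => ?_)
      simp [increment, mul_sub]
    · exact hi ⟨fun x => fourier (-l) x • f (x + (h : Torus L)), by fun_prop⟩
    · exact hi ⟨fun x => fourier (-l) x • f x, by fun_prop⟩
  rw [h2, h1]
  ring

theorem mem_Hs_one_iff {f : C(Torus L, ℂ)} :
    f ∈ Hs L 1 ↔ Summable (fun l : ℤ => freq L l ^ 2 * ‖fourierCoeff f l‖ ^ 2) := by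
  have e : ∀ l : ℤ, ENNReal.ofReal ((1 + freq L l ^ 2) ^ (1 : ℝ)) * ‖fourierCoeff f l‖ₑ ^ 2 =
      ENNReal.ofReal ((1 + freq L l ^ 2) * ‖fourierCoeff f l‖ ^ 2) := by
    intro l
    rw [Real.rpow_one, ENNReal.ofReal_mul (by positivity), ENNReal.ofReal_pow (norm_nonneg _),
      ofReal_norm]
  have h0 : f ∈ Hs L 1 ↔ Summable (fun l : ℤ => (1 + freq L l ^ 2) * ‖fourierCoeff f l‖ ^ 2) := by
    change sobolevNorm 1 f < ⊤ ↔ _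
    rw [sobolevNorm_lt_top_iff]
    simp only [e]
    constructor
    · intro h
      have := ENNReal.summable_toReal h.ne
      refine this.congr fun l => ?_
      rw [ENNReal.toReal_ofReal (by positivity)]
    · intro h
      exact h.tsum_ofReal_lt_top
  have hs := (hasSum_sq_fourierCoeff_cont f).summable
  rw [h0]
  constructor
  · intro h
    refine (h.sub hs).congr fun l => by ring
  · intro h
    refine (h.add hs).congr fun l => by ring

theorem fourier_coe_eq (l : ℤ) (h : ℝ) :
    (fourier l (h : Torus L) : ℂ) = Complex.exp (Complex.I * ((freq L l * h : ℝ) : ℂ)) := by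
  rw [fourier_coe_apply]
  congr 1
  unfold freq
  push_cast
  have : (L : ℂ) ≠ 0 := by
    have h := (Fact.out : 0 < 2 * L)
    exact_mod_cast (by intro h0; simp [h0] at h : L ≠ 0)
  field_simp

/-- `|f|^2` belongs to `H^1` if `f` does. -/
theorem absSq_mem {f : C(Torus L, ℂ)} (hf : f ∈ Hs L 1) : absSq f ∈ Hs L 1 := by
  rw [mem_Hs_one_iff] at hf ⊢
  set S := ∑' l : ℤ, freq L l ^ 2 * ‖fourierCoeff f l‖ ^ 2 with hS
  set M := ‖f‖
  have hM : ∀ x, ‖f x‖ ≤ M := fun x => f.norm_coe_le_norm x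
  have ci : ∀ g : C(Torus L, ℂ),
      Integrable (fun x => ‖g x‖ ^ 2) (AddCircle.haarAddCircle : Measure (Torus L)) := fun g =>
    (by fun_prop : Continuous fun x => ‖g x‖ ^ 2).integrable_of_hasCompactSupport
      (HasCompactSupport.of_compactSpace _)
  have bound : ∀ (F : Finset ℤ) (h : ℝ),
      ∑ l ∈ F, ‖(fourier l (h : Torus L) : ℂ) - 1‖ ^ 2 * ‖fourierCoeff (absSq f) l‖ ^ 2 ≤
        4 * M ^ 2 * (h ^ 2 * S) := by
    intro F h
    have p1 := hasSum_sq_fourierCoeff_cont (increment h (absSq f))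
    have p2 := hasSum_sq_fourierCoeff_cont (increment h f)
    simp only [fourierCoeff_increment, norm_mul, mul_pow] at p1 p2
    have a1 := sum_le_hasSum F (fun l _ => by positivity) p1
    have a2 : ∫ x, ‖increment h (absSq f) x‖ ^ 2 ∂(AddCircle.haarAddCircle : Measure (Torus L)) ≤
        4 * M ^ 2 * ∫ x, ‖increment h f x‖ ^ 2 ∂(AddCircle.haarAddCircle : Measure (Torus L)) := by
      rw [← integral_const_mul]
      refine integral_mono (ci _) ((ci _).const_mul _) fun x => ?_
      change ‖((‖f (x + h)‖ ^ 2 : ℝ) : ℂ) - ((‖f x‖ ^ 2 : ℝ) : ℂ)‖ ^ 2 ≤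
        4 * M ^ 2 * ‖f (x + h) - f x‖ ^ 2
      rw [← Complex.ofReal_sub, Complex.norm_real, Real.norm_eq_abs, sq_abs]
      have q1 := abs_le.1 (abs_norm_sub_norm_le (f (x + h)) (f x))
      have q2 : (‖f (x + h)‖ - ‖f x‖) ^ 2 ≤ ‖f (x + h) - f x‖ ^ 2 := by
        rw [sq_le_sq, abs_norm]; exact abs_le.2 q1
      have q3 : (‖f (x + h)‖ + ‖f x‖) ^ 2 ≤ 4 * M ^ 2 := by
        nlinarith [hM x, hM (x + h), norm_nonneg (f x), norm_nonneg (f (x + h))]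
      calc (‖f (x + h)‖ ^ 2 - ‖f x‖ ^ 2) ^ 2
          = (‖f (x + h)‖ + ‖f x‖) ^ 2 * (‖f (x + h)‖ - ‖f x‖) ^ 2 := by ring
        _ ≤ _ := by gcongr
    have a3 : ∫ x, ‖increment h f x‖ ^ 2 ∂(AddCircle.haarAddCircle : Measure (Torus L)) ≤
        h ^ 2 * S := by
      refine hasSum_le (fun l => ?_) p2 (hf.hasSum.mul_left (h ^ 2))
      have : ‖(fourier l (h : Torus L) : ℂ) - 1‖ ≤ |freq L l * h| := by
        rw [fourier_coe_eq]
        exact Real.norm_exp_I_mul_ofReal_sub_one_le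
      have : ‖(fourier l (h : Torus L) : ℂ) - 1‖ ^ 2 ≤ freq L l ^ 2 * h ^ 2 := by
        rw [← mul_pow, ← sq_abs (freq L l * h)]
        gcongr
      calc _ ≤ freq L l ^ 2 * h ^ 2 * ‖fourierCoeff f l‖ ^ 2 := by gcongr
        _ = _ := by ring
    calc _ ≤ _ := a1
      _ ≤ _ := a2
      _ ≤ _ := by gcongr
  have lim : ∀ l : ℤ, Tendsto (fun h : ℝ => ‖(fourier l (h : Torus L) : ℂ) - 1‖ ^ 2 / h ^ 2)
      (𝓝[≠] 0) (𝓝 (freq L l ^ 2)) := by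
    intro l
    have d : HasDerivAt (fun h : ℝ => (fourier l (h : Torus L) : ℂ))
        (Complex.I * (freq L l : ℂ)) 0 := by
      have d1 : HasDerivAt (fun h : ℝ => Complex.I * ((freq L l * h : ℝ) : ℂ))
          (Complex.I * (freq L l : ℂ)) 0 := by
        have := ((hasDerivAt_id (0 : ℝ)).const_mul (freq L l)).ofReal_comp.const_mul Complex.I
        simpa using this
      have := d1.cexp
      simp only [fourier_coe_eq]
      simpa using this
    have := ((hasDerivAt_iff_tendsto_slope.1 d).norm.pow 2)
    simp only [slope_def_module, norm_mul, Complex.norm_I, Complex.norm_real, one_mul,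
      Real.norm_eq_abs, sq_abs] at this
    refine this.congr fun h => ?_
    rw [sub_zero, norm_smul, mul_pow, norm_inv, Real.norm_eq_abs, inv_pow, sq_abs]
    simp [div_eq_inv_mul]
  refine summable_of_sum_le (c := 4 * M ^ 2 * S) (fun l => by positivity) fun F => ?_
  have t : Tendsto (fun h : ℝ => ∑ l ∈ F, ‖(fourier l (h : Torus L) : ℂ) - 1‖ ^ 2 / h ^ 2 *
      ‖fourierCoeff (absSq f) l‖ ^ 2) (𝓝[≠] 0)
      (𝓝 (∑ l ∈ F, freq L l ^ 2 * ‖fourierCoeff (absSq f) l‖ ^ 2)) :=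
    tendsto_finsetSum _ fun l _ => (lim l).mul_const _
  refine le_of_tendsto t ?_
  filter_upwards [self_mem_nhdsWithin] with h hh
  have hh' : (0 : ℝ) < h ^ 2 := by
    have : h ≠ 0 := hh
    positivity
  have := bound F h
  have e : ∑ l ∈ F, ‖(fourier l (h : Torus L) : ℂ) - 1‖ ^ 2 / h ^ 2 *
      ‖fourierCoeff (absSq f) l‖ ^ 2 = (∑ l ∈ F, ‖(fourier l (h : Torus L) : ℂ) - 1‖ ^ 2 *
      ‖fourierCoeff (absSq f) l‖ ^ 2) / h ^ 2 := by
    rw [Finset.sum_div]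
    exact Finset.sum_congr rfl fun l _ => by ring
  rw [e, div_le_iff₀ hh']
  linarith

/-- The density `|f|^2` of a wave function `f ∈ H^1`, as an element of `H^1`. -/
def density (f : Hs L 1) : Hs L 1 := ⟨absSq f.1, absSq_mem f.2⟩

/-- `G` is a bounded linear functional on `H^1`, that is, an element of the dual `(H^1)'`. -/
def IsBoundedOnH1 (G : Hs L 1 →ₗ[ℂ] ℂ) : Prop :=
  ∃ K : ℝ≥0, ∀ f : Hs L 1, ‖G f‖ₑ ≤ K * sobolevNorm 1 f.1

/-- A real valued function, regarded as a complex valued one. -/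
def toComplex (W : C(Torus L, ℝ)) : C(Torus L, ℂ) where
  toFun x := (W x : ℂ)
  continuous_toFun := by fun_prop

end Sobolev

section Potential

variable {L : ℝ} [Fact (0 < 2 * L)]

/-- The parameter domain `U = [-1/2, 1/2]^ℕ`. -/
def paramDomain : Set (ℕ → ℝ) := {ξ | ∀ j, ξ j ∈ Set.Icc (-1 / 2 : ℝ) (1 / 2)}

/-- The truncated parameter domain `U_m = [-1/2, 1/2]^m`. -/
def paramDomainTrunc (m : ℕ) : Set (Fin m → ℝ) := {ξ | ∀ j, ξ j ∈ Set.Icc (-1 / 2 : ℝ) (1 / 2)}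

/-- The uniform distribution on `[-1/2, 1/2]`. -/
def uniformLaw : Measure ℝ := volume.restrict (Set.Icc (-1 / 2 : ℝ) (1 / 2))

instance : IsProbabilityMeasure uniformLaw := ⟨by
  rw [uniformLaw, Measure.restrict_apply_univ, Real.volume_Icc]
  norm_num⟩

/-- The law of a sequence of i.i.d. uniform random variables on `[-1/2, 1/2]`. -/
def paramLaw : Measure (ℕ → ℝ) := Measure.infinitePi fun _ => uniformLaw

/-- The random potential `V(ξ, x) = v₀(x) + ∑_{j ≥ 1} √λ_j ξ_j v_j(x)`, the series being taken in
the uniform norm. The index `j : ℕ` of `lam`, `v` and `ξ` stands for the index `j + 1` of the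
series. -/
def potential (v₀ : C(Torus L, ℝ)) (lam : ℕ → ℝ) (v : ℕ → C(Torus L, ℝ)) (ξ : ℕ → ℝ) :
    C(Torus L, ℝ) :=
  v₀ + ∑' j : ℕ, (Real.sqrt (lam j) * ξ j) • v j

/-- The truncated potential `V_m(ξ, x) = v₀(x) + ∑_{j = 1}^m √λ_j ξ_j v_j(x)`. -/
def potentialTrunc (v₀ : C(Torus L, ℝ)) (lam : ℕ → ℝ) (v : ℕ → C(Torus L, ℝ)) (m : ℕ)
    (ξ : Fin m → ℝ) : C(Torus L, ℝ) :=
  v₀ + ∑ j : Fin m, (Real.sqrt (lam j) * ξ j) • v j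

/-- The norm of `L^∞(U; H^s)`, `sup_{ξ ∈ U} ‖W(ξ)‖_{H^s}`. -/
def supSobolevNorm (s : ℝ) (W : (ℕ → ℝ) → C(Torus L, ℝ)) : ℝ≥0∞ :=
  ⨆ ξ ∈ paramDomain, sobolevNorm s (toComplex (W ξ))

/-- The truncated potential as a function on the full parameter domain, through the first `m`
parameters. -/
def potentialTruncFull (v₀ : C(Torus L, ℝ)) (lam : ℕ → ℝ) (v : ℕ → C(Torus L, ℝ)) (m : ℕ)
    (ξ : ℕ → ℝ) : C(Torus L, ℝ) :=
  potentialTrunc v₀ lam v m fun j : Fin m => ξ j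

/-- The basic assumptions on the functional, the initial datum and the potential: `G ∈ (H^1)'`,
`ψ_in ∈ H^s`, `V ∈ L^∞(U; H^s)` and `‖V_m‖_{L^∞(U; H^s)} ≤ ‖V‖_{L^∞(U; H^s)}` for `m > 0`. -/
structure BasicAssumption (s : ℝ) (v₀ : C(Torus L, ℝ)) (lam : ℕ → ℝ) (v : ℕ → C(Torus L, ℝ))
    (ψin : C(Torus L, ℂ)) (G : Hs L 1 →ₗ[ℂ] ℂ) : Prop where
  functional_bounded : IsBoundedOnH1 G
  initial_mem : ψin ∈ Hs L s
  potential_bounded : supSobolevNorm s (potential v₀ lam v) < ⊤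
  trunc_le : ∀ m : ℕ, 0 < m →
    supSobolevNorm s (potentialTruncFull v₀ lam v m) ≤ supSobolevNorm s (potential v₀ lam v)

/-- The decay assumption on the potential: `‖V_m - V‖_{L^∞(U; H^1)} ≤ C m^{-χ}` for `m > 0`, and
`∑_{j ≥ 1} (3^j √λ_j ‖v_j‖_{H^1})^{1/2} < ∞`. -/
structure DecayAssumption (χ : ℝ) (v₀ : C(Torus L, ℝ)) (lam : ℕ → ℝ) (v : ℕ → C(Torus L, ℝ)) :
    Prop where
  trunc_rate : ∃ C : ℝ, 0 < C ∧ ∀ m : ℕ, 0 < m →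
    supSobolevNorm 1 (fun ξ => potentialTruncFull v₀ lam v m ξ - potential v₀ lam v ξ) ≤
      ENNReal.ofReal (C * (m : ℝ) ^ (-χ))
  summable : ∑' j : ℕ, (ENNReal.ofReal (3 ^ (j + 1) * Real.sqrt (lam j)) *
    sobolevNorm 1 (toComplex (v j))) ^ (1 / 2 : ℝ) < ⊤

end Potential

section Equation

variable {L : ℝ} [Fact (0 < 2 * L)]

/-- `u ∈ C([0, T]; H^1)` is a mild solution on `[0, T]` of
`i ∂_t u = -(1/2) ∂_x^2 u + W u + α |u|^2 u`, `u(0) = ψ_in`, that is, it satisfies Duhamel's formula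
`u(t) = e^{it∂_x^2/2} ψ_in - i ∫_0^t e^{i(t-ρ)∂_x^2/2} [W u(ρ) + α |u(ρ)|^2 u(ρ)] dρ`. The latter
is an identity in `H^1` and is written out for each Fourier coefficient; `e^{it∂_x^2/2}` multiplies
the `l`-th coefficient by `e^{-it(π l / L)^2/2}`. -/
structure IsMildSolution (T α : ℝ) (W : C(Torus L, ℝ)) (ψin : C(Torus L, ℂ)) (u : ℝ → Hs L 1) :
    Prop where
  continuous_H1 : ∀ t₀ ∈ Set.Icc 0 T,
    Tendsto (fun t => sobolevNorm 1 ((u t).1 - (u t₀).1)) (𝓝[Set.Icc 0 T] t₀) (𝓝 0)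
  duhamel : ∀ t ∈ Set.Icc 0 T, ∀ l : ℤ,
    fourierCoeff (u t).1 l =
      Complex.exp (-Complex.I * (t * freq L l ^ 2 / 2)) * fourierCoeff ψin l
        - Complex.I * ∫ ρ in (0 : ℝ)..t, Complex.exp (-Complex.I * ((t - ρ) * freq L l ^ 2 / 2)) *
            fourierCoeff (toComplex W * (u ρ).1 + (α : ℂ) • (absSq (u ρ).1 * (u ρ).1)) l

end Equation

end

/-! The observable is a Lipschitz function of the potential in `H¹`, uniformly in `t`. The truncated
potential `V_m(ξ)` is `V` at another point of `U`: `ξ` with all components after the `m`-th set to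
zero. By uniqueness (`IsMildSolution.eq_of_mem_Icc`) `ψ_m` is then `ψ` at that point, and the rate
`m^{-χ}` of the potentials passes to the observables pointwise in `ξ`. The first `m` coordinates
carry the product law to Lebesgue measure on `U_m` (`measurePreserving_truncParam`), so both
expectations are integrals over `U`, and the pointwise bound integrates.

The Lipschitz estimate (`IsMildSolution.norm_embed_sub_le`) comes from Duhamel's formula, the
unitarity of the free group, the algebra property of `H¹` and Grönwall's inequality. Its constant
involves a bound on the solutions that must be uniform in `ξ`. No conservation law is used: each
solution is bounded as a continuous curve on `[0, T]`, a continuity argument extends the bound to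
nearby potentials (`IsMildSolution.norm_embed_sub_le_one`), and compactness of `U` finishes
(`exists_uniform_bound`). This needs `ξ ↦ V(ξ)` to be continuous into `H¹`, which holds because `V_m
→ V` uniformly on `U`.

As a subspace of the continuous functions, `Hs L 1` inherits the sup norm; the `H¹` norm is
therefore written `‖embed f‖` throughout. -/

/-- A constant of the embedding of `H¹` into the continuous functions. -/
noncomputable def embeddingConst (L : ℝ) : ℝ := Real.sqrt (∑' l : ℤ, (1 + freq L l ^ 2)⁻¹) + 1

theorem embeddingConst_pos {L : ℝ} : 0 < embeddingConst L := by
  unfold embeddingConst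
  positivity

/-- A constant of the product estimate in `H¹`. -/
noncomputable def algebraConst (L : ℝ) : ℝ := 2 * embeddingConst L

theorem algebraConst_pos {L : ℝ} : 0 < algebraConst L := mul_pos two_pos embeddingConst_pos

/-! ### The `H¹` norm: embedding, difference quotients, products -/

section SobolevOne

variable {L : ℝ} [Fact (0 < 2 * L)]

theorem sobolevNorm_one_sq (f : C(Torus L, ℂ)) :
    sobolevNorm 1 f = (∑' l : ℤ, ENNReal.ofReal ((1 + freq L l ^ 2) * ‖fourierCoeff f l‖ ^ 2)) ^
      (1 / 2 : ℝ) := by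
  unfold sobolevNorm
  congr 2
  ext l
  rw [Real.rpow_one, ENNReal.ofReal_mul (by positivity), ENNReal.ofReal_pow (norm_nonneg _),
    ofReal_norm]

theorem mem_Hs_one_iff_summable {f : C(Torus L, ℂ)} :
    f ∈ Hs L 1 ↔ Summable (fun l : ℤ => (1 + freq L l ^ 2) * ‖fourierCoeff f l‖ ^ 2) := by
  rw [mem_Hs_one_iff]
  have hs := (hasSum_sq_fourierCoeff_cont f).summable
  constructor
  · intro h
    refine (h.add hs).congr fun l => by ring
  · intro h
    refine (h.sub hs).congr fun l => by ring

/-- The Fourier coefficients of `f`, weighted so that their `ℓ²` norm is the `H¹` norm of `f`. -/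
noncomputable def weightedCoeff (f : C(Torus L, ℂ)) (l : ℤ) : ℂ :=
  (Real.sqrt (1 + freq L l ^ 2) : ℂ) * fourierCoeff f l

theorem norm_weightedCoeff_sq (f : C(Torus L, ℂ)) (l : ℤ) :
    ‖weightedCoeff f l‖ ^ 2 = (1 + freq L l ^ 2) * ‖fourierCoeff f l‖ ^ 2 := by
  rw [weightedCoeff, norm_mul, mul_pow, Complex.norm_real, Real.norm_eq_abs, sq_abs,
    Real.sq_sqrt (by positivity)]

theorem memℓp_weightedCoeff (f : Hs L 1) : Memℓp (weightedCoeff f.1) 2 := by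
  apply memℓp_gen
  have := mem_Hs_one_iff_summable.1 f.2
  simpa [← norm_weightedCoeff_sq] using this

/-- The embedding of `H¹` into `ℓ²(ℤ)` that carries the `H¹` norm to the `ℓ²` norm. -/
noncomputable def embed : Hs L 1 →ₗ[ℂ] lp (fun _ : ℤ => ℂ) 2 where
  toFun f := ⟨weightedCoeff f.1, memℓp_weightedCoeff f⟩
  map_add' f g := by
    ext l
    change weightedCoeff (f.1 + g.1) l = weightedCoeff f.1 l + weightedCoeff g.1 l
    simp only [weightedCoeff, fourierCoeff_add_cont]
    ring
  map_smul' c f := by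
    ext l
    change weightedCoeff (c • f.1) l = c * weightedCoeff f.1 l
    have : fourierCoeff (c • f.1 : C(Torus L, ℂ)) l = c * fourierCoeff f.1 l := by
      simpa using fourierCoeff.const_smul (f.1 : Torus L → ℂ) c l
    simp only [weightedCoeff, this]
    ring

theorem hasSum_norm_embed_sq (f : Hs L 1) :
    HasSum (fun l : ℤ => (1 + freq L l ^ 2) * ‖fourierCoeff f.1 l‖ ^ 2) (‖embed f‖ ^ 2) := by
  have := lp.hasSum_norm (p := 2) (by norm_num) (embed f)
  simp only [ENNReal.toReal_ofNat, Real.rpow_ofNat] at this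
  exact this.congr_fun fun l => (norm_weightedCoeff_sq f.1 l).symm

theorem sobolevNorm_one_eq (f : Hs L 1) : sobolevNorm 1 f.1 = ENNReal.ofReal ‖embed f‖ := by
  rw [sobolevNorm_one_sq, ← ENNReal.ofReal_tsum_of_nonneg (fun l => by positivity)
    (hasSum_norm_embed_sq f).summable, (hasSum_norm_embed_sq f).tsum_eq,
    ENNReal.ofReal_rpow_of_nonneg (by positivity) (by norm_num), ← Real.sqrt_eq_rpow,
    Real.sqrt_sq (norm_nonneg _)]

theorem summable_inv_one_add_freq_sq : Summable fun l : ℤ => (1 + freq L l ^ 2)⁻¹ := by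
  have hL : 0 < L := by
    have h := (Fact.out : 0 < 2 * L)
    linarith
  have h := (Real.summable_one_div_int_pow (p := 2)).2 (by norm_num)
  -- The mode `l = 0` is left out: the majorant is `1 / 0 = 0` there, the term is `1`.
  refine Summable.of_norm_bounded_eventually (h.mul_left ((L / Real.pi) ^ 2)) ?_
  have : ∀ᶠ l : ℤ in cofinite, l ≠ 0 := by
    simpa using (Set.finite_singleton (0 : ℤ)).eventually_cofinite_notMem
  filter_upwards [this] with l hl
  have hl' : (0 : ℝ) < (l : ℝ) ^ 2 := by positivity
  rw [Real.norm_of_nonneg (by positivity)]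
  have e : (L / Real.pi) ^ 2 * (1 / (l : ℝ) ^ 2) = (freq L l ^ 2)⁻¹ := by
    unfold freq
    field_simp
  rw [e]
  have : 0 < freq L l ^ 2 := by unfold freq; positivity
  gcongr
  linarith

/-- Cauchy–Schwarz against the weights `(1 + freq²)^{-1/2}` makes the Fourier coefficients summable,
so the Fourier series converges uniformly to `f`. -/
theorem norm_le_embed (f : Hs L 1) : ‖f.1‖ ≤ embeddingConst L * ‖embed f‖ := by
  have h1 := hasSum_norm_embed_sq f
  have h2 := (summable_inv_one_add_freq_sq (L := L))
  obtain ⟨k1, k2⟩ := Real.summable_and_inner_le_Lp_mul_Lq_tsum_of_nonneg (p := 2) (q := 2)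
    (f := fun l : ℤ => Real.sqrt (1 + freq L l ^ 2)⁻¹)
    (g := fun l : ℤ => ‖weightedCoeff f.1 l‖) (by constructor <;> norm_num)
    (fun l => by positivity) (fun l => by positivity)
    (by
      simp only [Real.rpow_ofNat]
      refine h2.congr fun l => ?_
      rw [Real.sq_sqrt (by positivity)])
    (by simpa [norm_weightedCoeff_sq] using h1.summable)
  have e : ∀ l : ℤ, Real.sqrt (1 + freq L l ^ 2)⁻¹ * ‖weightedCoeff f.1 l‖ =
      ‖fourierCoeff f.1 l‖ := by
    intro l
    rw [weightedCoeff, norm_mul, Complex.norm_real, Real.norm_of_nonneg (by positivity),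
      ← mul_assoc, ← Real.sqrt_mul (by positivity), inv_mul_cancel₀ (by positivity)]
    simp
  simp only [e, Real.rpow_ofNat, norm_weightedCoeff_sq, h1.tsum_eq] at k1 k2
  have e2 : ∀ l : ℤ, Real.sqrt (1 + freq L l ^ 2)⁻¹ ^ 2 = (1 + freq L l ^ 2)⁻¹ :=
    fun l => Real.sq_sqrt (by positivity)
  simp only [e2, ← Real.sqrt_eq_rpow, Real.sqrt_sq (norm_nonneg _)] at k2
  have k3 := hasSum_fourier_series_of_summable (f := f.1) k1.of_norm
  have k4 : ‖f.1‖ ≤ ∑' l : ℤ, ‖fourierCoeff f.1 l‖ := by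
    have e3 : ∀ l : ℤ, ‖fourierCoeff f.1 l • (fourier l : C(Torus L, ℂ))‖ =
        ‖fourierCoeff f.1 l‖ := fun l => by
      rw [norm_smul, fourier_norm, mul_one]
    have k5 := norm_tsum_le_tsum_norm (f := fun l : ℤ => fourierCoeff f.1 l •
      (fourier l : C(Torus L, ℂ))) (by simpa only [e3] using k1)
    simpa only [k3.tsum_eq, e3] using k5
  calc ‖f.1‖ ≤ _ := k4
    _ ≤ _ := k2
    _ ≤ _ := by
      unfold embeddingConst
      gcongr
      linarith

/-- Parseval, together with `|e^{iθ} - 1| ≤ |θ|` in each mode. Difference quotients make pointwise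
inequalities usable in `H¹` without weak derivatives. -/
theorem integral_add_increment_le (f : Hs L 1) {h : ℝ} (hh : h ≠ 0) :
    (∫ x, ‖f.1 x‖ ^ 2 ∂(AddCircle.haarAddCircle : Measure (Torus L))) +
      (∫ x, ‖increment h f.1 x‖ ^ 2 ∂(AddCircle.haarAddCircle : Measure (Torus L))) / h ^ 2 ≤
      ‖embed f‖ ^ 2 := by
  have p1 := hasSum_sq_fourierCoeff_cont f.1
  have p2 := (hasSum_sq_fourierCoeff_cont (increment h f.1)).div_const (h ^ 2)
  refine hasSum_le (fun l => ?_) (p1.add p2) (hasSum_norm_embed_sq f)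
  have hh' : 0 < h ^ 2 := by positivity
  have h1 : ‖(fourier l (h : Torus L) : ℂ) - 1‖ ≤ |freq L l * h| := by
    rw [fourier_coe_eq]
    exact Real.norm_exp_I_mul_ofReal_sub_one_le
  have h2 : ‖(fourier l (h : Torus L) : ℂ) - 1‖ ^ 2 ≤ freq L l ^ 2 * h ^ 2 := by
    rw [← mul_pow, ← sq_abs (freq L l * h)]
    gcongr
  rw [fourierCoeff_increment, norm_mul, mul_pow, add_mul, one_mul]
  gcongr
  rw [div_le_iff₀ hh']
  calc _ ≤ freq L l ^ 2 * h ^ 2 * ‖fourierCoeff f.1 l‖ ^ 2 := by gcongr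
    _ = _ := by ring

theorem tendsto_norm_fourier_sub_one_sq_div (l : ℤ) :
    Tendsto (fun h : ℝ => ‖(fourier l (h : Torus L) : ℂ) - 1‖ ^ 2 / h ^ 2)
      (𝓝[≠] 0) (𝓝 (freq L l ^ 2)) := by
  have d : HasDerivAt (fun h : ℝ => (fourier l (h : Torus L) : ℂ))
      (Complex.I * (freq L l : ℂ)) 0 := by
    have d1 : HasDerivAt (fun h : ℝ => Complex.I * ((freq L l * h : ℝ) : ℂ))
        (Complex.I * (freq L l : ℂ)) 0 := by
      have := ((hasDerivAt_id (0 : ℝ)).const_mul (freq L l)).ofReal_comp.const_mul Complex.I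
      simpa using this
    have := d1.cexp
    simp only [fourier_coe_eq]
    simpa using this
  have := ((hasDerivAt_iff_tendsto_slope.1 d).norm.pow 2)
  simp only [slope_def_module, norm_mul, Complex.norm_I, Complex.norm_real, one_mul,
    Real.norm_eq_abs, sq_abs] at this
  refine this.congr fun h => ?_
  rw [sub_zero, norm_smul, mul_pow, norm_inv, Real.norm_eq_abs, inv_pow, sq_abs]
  simp [div_eq_inv_mul]

/-- Converse of the previous bound: let `h → 0` in finitely many modes at a time, then enlarge the
set of modes. Membership and estimate come together, since the estimate cannot be stated before
membership is known. -/
theorem exists_embed_sq_le_of_increment {f : C(Torus L, ℂ)} {Q : ℝ}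
    (H : ∀ h : ℝ, h ≠ 0 → (∫ x, ‖f x‖ ^ 2 ∂(AddCircle.haarAddCircle : Measure (Torus L))) +
      (∫ x, ‖increment h f x‖ ^ 2 ∂(AddCircle.haarAddCircle : Measure (Torus L))) / h ^ 2 ≤ Q) :
    ∃ hf : f ∈ Hs L 1, ‖embed ⟨f, hf⟩‖ ^ 2 ≤ Q := by
  have bound : ∀ F : Finset ℤ, ∑ l ∈ F, (1 + freq L l ^ 2) * ‖fourierCoeff f l‖ ^ 2 ≤ Q := by
    intro F
    have t : Tendsto (fun h : ℝ => ∑ l ∈ F, (1 + ‖(fourier l (h : Torus L) : ℂ) - 1‖ ^ 2 / h ^ 2) *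
        ‖fourierCoeff f l‖ ^ 2) (𝓝[≠] 0)
        (𝓝 (∑ l ∈ F, (1 + freq L l ^ 2) * ‖fourierCoeff f l‖ ^ 2)) :=
      tendsto_finsetSum _ fun l _ =>
        ((tendsto_norm_fourier_sub_one_sq_div l).const_add 1).mul_const _
    refine le_of_tendsto t ?_
    filter_upwards [self_mem_nhdsWithin] with h hh
    refine le_trans ?_ (H h hh)
    have p1 := hasSum_sq_fourierCoeff_cont f
    have p2 := (hasSum_sq_fourierCoeff_cont (increment h f)).div_const (h ^ 2)
    refine le_trans (Finset.sum_le_sum fun l _ => ?_)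
      (sum_le_hasSum F (fun l _ => by positivity) (p1.add p2))
    rw [fourierCoeff_increment, norm_mul, mul_pow]
    exact le_of_eq (by ring)
  have hf : f ∈ Hs L 1 :=
    mem_Hs_one_iff_summable.2 (summable_of_sum_le (fun l => by positivity) bound)
  exact ⟨hf, hasSum_le_of_sum_le (hasSum_norm_embed_sq ⟨f, hf⟩) bound⟩

theorem integrable_norm_sq_haar (f : C(Torus L, ℂ)) :
    Integrable (fun x => ‖f x‖ ^ 2) (AddCircle.haarAddCircle : Measure (Torus L)) :=
  (by fun_prop : Continuous fun x => ‖f x‖ ^ 2).integrable_of_hasCompactSupport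
    (HasCompactSupport.of_compactSpace _)

theorem integral_norm_sq_le_of_norm_le {F f g : C(Torus L, ℂ)} {A B : ℝ}
    (H : ∀ x, ‖F x‖ ≤ A * ‖f x‖ + B * ‖g x‖) :
    ∫ x, ‖F x‖ ^ 2 ∂(AddCircle.haarAddCircle : Measure (Torus L)) ≤
      2 * A ^ 2 * (∫ x, ‖f x‖ ^ 2 ∂(AddCircle.haarAddCircle : Measure (Torus L))) +
      2 * B ^ 2 * ∫ x, ‖g x‖ ^ 2 ∂(AddCircle.haarAddCircle : Measure (Torus L)) := by
  have hf := (integrable_norm_sq_haar f).const_mul (2 * A ^ 2)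
  have hg := (integrable_norm_sq_haar g).const_mul (2 * B ^ 2)
  rw [← integral_const_mul, ← integral_const_mul, ← integral_add hf hg]
  refine integral_mono (integrable_norm_sq_haar F) (hf.add hg) fun x => ?_
  have h := pow_le_pow_left₀ (norm_nonneg _) (H x) 2
  have h' := sq_nonneg (A * ‖f x‖ - B * ‖g x‖)
  change ‖F x‖ ^ 2 ≤ 2 * A ^ 2 * ‖f x‖ ^ 2 + 2 * B ^ 2 * ‖g x‖ ^ 2
  linarith

/-- A function whose values and increments are controlled by those of two functions in `H¹` is
in `H¹`. -/
theorem exists_embed_sq_le_of_pointwise (f g : Hs L 1) {F : C(Torus L, ℂ)} {A B : ℝ}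
    (h0 : ∀ x, ‖F x‖ ≤ A * ‖f.1 x‖ + B * ‖g.1 x‖)
    (h1 : ∀ x y, ‖F x - F y‖ ≤ A * ‖f.1 x - f.1 y‖ + B * ‖g.1 x - g.1 y‖) :
    ∃ hF : F ∈ Hs L 1, ‖embed ⟨F, hF⟩‖ ^ 2 ≤
      2 * A ^ 2 * ‖embed f‖ ^ 2 + 2 * B ^ 2 * ‖embed g‖ ^ 2 := by
  refine exists_embed_sq_le_of_increment fun h hh => ?_
  have hh' : 0 < h ^ 2 := by positivity
  have c0 := integral_norm_sq_le_of_norm_le h0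
  have c1 := integral_norm_sq_le_of_norm_le (F := increment h F) (f := increment h f.1)
    (g := increment h g.1) fun x => h1 (x + (h : Torus L)) x
  have c2 := div_le_div_of_nonneg_right c1 hh'.le
  have q1 := mul_le_mul_of_nonneg_left (integral_add_increment_le f hh)
    (show 0 ≤ 2 * A ^ 2 by positivity)
  have q2 := mul_le_mul_of_nonneg_left (integral_add_increment_le g hh)
    (show 0 ≤ 2 * B ^ 2 by positivity)
  refine (add_le_add c0 c2).trans (le_trans (le_of_eq ?_) (add_le_add q1 q2))
  ring

theorem exists_embed_mul_le (f g : Hs L 1) : ∃ h : f.1 * g.1 ∈ Hs L 1,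
    ‖embed ⟨f.1 * g.1, h⟩‖ ≤ algebraConst L * ‖embed f‖ * ‖embed g‖ := by
  have mf := norm_le_embed f
  have mg := norm_le_embed g
  have hc := embeddingConst_pos (L := L)
  -- `A` and `B` bound the sup norms of `g` and `f`, as in the product rule. Then `2A²‖f‖² +
  -- 2B²‖g‖²` is the square of `2c‖f‖‖g‖` with `c` the embedding constant, whence `algebraConst`.
  obtain ⟨h, H⟩ := exists_embed_sq_le_of_pointwise f g (F := f.1 * g.1)
    (A := embeddingConst L * ‖embed g‖) (B := embeddingConst L * ‖embed f‖)
    (fun x => by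
      have := (g.1.norm_coe_le_norm x).trans mg
      rw [ContinuousMap.mul_apply, norm_mul]
      nlinarith [norm_nonneg (f.1 x), mul_nonneg (mul_nonneg hc.le (norm_nonneg (embed f)))
        (norm_nonneg (g.1 x))])
    (fun x y => by
      have hg := (g.1.norm_coe_le_norm x).trans mg
      have hf := (f.1.norm_coe_le_norm y).trans mf
      have e : (f.1 * g.1) x - (f.1 * g.1) y =
          g.1 x * (f.1 x - f.1 y) + f.1 y * (g.1 x - g.1 y) := by
        simp only [ContinuousMap.mul_apply]; ring
      rw [e]
      refine (norm_add_le _ _).trans ?_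
      rw [norm_mul, norm_mul]
      gcongr)
  refine ⟨h, le_of_sq_le_sq ?_ (by have := algebraConst_pos (L := L); positivity)⟩
  refine H.trans (le_of_eq ?_)
  unfold algebraConst
  ring

/-- Conjugation preserves the moduli of values and increments; using these avoids the reflection `l
↦ -l` of the coefficients. -/
theorem exists_embed_star_le (f : Hs L 1) : ∃ h : star f.1 ∈ Hs L 1,
    ‖embed ⟨star f.1, h⟩‖ ≤ ‖embed f‖ := by
  obtain ⟨h, H⟩ := exists_embed_sq_le_of_increment (f := star f.1) (Q := ‖embed f‖ ^ 2)
    fun h hh => by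
      refine le_trans (le_of_eq ?_) (integral_add_increment_le f hh)
      have e : ∀ x, ‖increment h (star f.1) x‖ = ‖increment h f.1 x‖ := fun x => by
        change ‖star (f.1 (x + (h : Torus L))) - star (f.1 x)‖ = _
        rw [← star_sub, norm_star]
        rfl
      simp only [e, ContinuousMap.star_apply, norm_star]
  exact ⟨h, le_of_sq_le_sq H (norm_nonneg _)⟩

end SobolevOne

theorem absSq_eq {L : ℝ} (f : C(Torus L, ℂ)) : absSq f = f * star f := by
  ext x
  change ((‖f x‖ ^ 2 : ℝ) : ℂ) = f x * (starRingEnd ℂ) (f x)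
  rw [Complex.mul_conj']
  push_cast
  rfl

/-! ### Cauchy–Schwarz in time and Grönwall's inequality -/

section Integral

/-- Expand the nonnegative integral of `(f - c)²`, where `c` is the mean of `f`. -/
theorem sq_intervalIntegral_le {f : ℝ → ℝ} {t : ℝ} (ht : 0 ≤ t)
    (hf : ContinuousOn f (Set.Icc 0 t)) :
    (∫ ρ in (0 : ℝ)..t, f ρ) ^ 2 ≤ t * ∫ ρ in (0 : ℝ)..t, f ρ ^ 2 := by
  rcases ht.eq_or_lt with rfl | ht'
  · simp
  have hf' : ContinuousOn f (Set.uIcc 0 t) := by rwa [Set.uIcc_of_le ht]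
  have i1 : IntervalIntegrable f volume 0 t := hf'.intervalIntegrable
  have i2 : IntervalIntegrable (fun ρ => f ρ ^ 2) volume 0 t := (hf'.pow 2).intervalIntegrable
  set c := (∫ ρ in (0 : ℝ)..t, f ρ) / t with hc
  have h0 : 0 ≤ ∫ ρ in (0 : ℝ)..t, (f ρ - c) ^ 2 :=
    intervalIntegral.integral_nonneg ht fun ρ _ => sq_nonneg _
  have e : ∫ ρ in (0 : ℝ)..t, (f ρ - c) ^ 2 =
      (∫ ρ in (0 : ℝ)..t, f ρ ^ 2) - 2 * c * (∫ ρ in (0 : ℝ)..t, f ρ) + c ^ 2 * t := by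
    have : ∀ ρ, (f ρ - c) ^ 2 = f ρ ^ 2 - 2 * c * f ρ + c ^ 2 := fun ρ => by ring
    simp only [this]
    rw [intervalIntegral.integral_add (i2.sub (i1.const_mul _)) intervalIntegrable_const,
      intervalIntegral.integral_sub i2 (i1.const_mul _), intervalIntegral.integral_const_mul,
      intervalIntegral.integral_const, smul_eq_mul]
    ring
  have hI : ∫ ρ in (0 : ℝ)..t, f ρ = c * t := by rw [hc]; field_simp
  rw [e, hI] at h0
  rw [hI]
  nlinarith

/-- Grönwall's inequality in integral form. -/
theorem le_of_le_add_integral {y : ℝ → ℝ} {T a b : ℝ} (hb : 0 < b)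
    (hy : ContinuousOn y (Set.Icc 0 T)) (ha : 0 ≤ a)
    (H : ∀ t ∈ Set.Icc 0 T, y t ≤ a + b * ∫ ρ in (0 : ℝ)..t, y ρ) :
    ∀ t ∈ Set.Icc 0 T, y t ≤ 2 * a * Real.exp (2 * b * t) := by
  intro t ht
  -- Let `M` be the maximum of `y` weighted by `e^{-2bt}`, attained at `τ`. As the rate is `2b` and
  -- not `b`, the integral term at `τ` is at most half of `M e^{2bτ}` and can be absorbed; this
  -- costs the factor `2` before `a`.
  have hz : ContinuousOn (fun t => y t * Real.exp (-(2 * b * t))) (Set.Icc 0 T) := by fun_prop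
  obtain ⟨τ, hτ, hmax⟩ := isCompact_Icc.exists_isMaxOn ⟨t, ht⟩ hz
  set M := y τ * Real.exp (-(2 * b * τ)) with hM
  have hyM : ∀ ρ ∈ Set.Icc 0 T, y ρ ≤ M * Real.exp (2 * b * ρ) := by
    intro ρ hρ
    have h : y ρ * Real.exp (-(2 * b * ρ)) ≤ M := hmax hρ
    rw [Real.exp_neg, ← div_eq_mul_inv, div_le_iff₀ (Real.exp_pos _)] at h
    exact h
  suffices hMa : M ≤ 2 * a from
    (hyM t ht).trans (mul_le_mul_of_nonneg_right hMa (Real.exp_pos _).le)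
  by_contra hlt
  have hMpos : 0 < M := by linarith
  have hint : ∫ ρ in (0 : ℝ)..τ, y ρ ≤ M * Real.exp (2 * b * τ) / (2 * b) := by
    have d : ∀ ρ ∈ Set.uIcc 0 τ, HasDerivAt (fun ρ => M * Real.exp (2 * b * ρ) / (2 * b))
        (M * Real.exp (2 * b * ρ)) ρ := by
      intro ρ _
      have h := ((((hasDerivAt_id ρ).const_mul (2 * b)).exp).const_mul M).div_const (2 * b)
      refine h.congr_deriv ?_
      simp only [id]
      field_simp
    have c : Continuous fun ρ => M * Real.exp (2 * b * ρ) := by fun_prop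
    have ftc := intervalIntegral.integral_eq_sub_of_hasDerivAt d (c.intervalIntegrable 0 τ)
    have hsub : Set.Icc 0 τ ⊆ Set.Icc 0 T := Set.Icc_subset_Icc_right hτ.2
    have hyi : IntervalIntegrable y volume 0 τ := by
      apply ContinuousOn.intervalIntegrable
      rw [Set.uIcc_of_le hτ.1]
      exact hy.mono hsub
    have hmono := intervalIntegral.integral_mono_on hτ.1 hyi (c.intervalIntegrable 0 τ)
      fun ρ hρ => hyM ρ (hsub hρ)
    have : 0 ≤ M * Real.exp (2 * b * 0) / (2 * b) := by positivity
    linarith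
  have h1 := H τ hτ
  have h2 : b * ∫ ρ in (0 : ℝ)..τ, y ρ ≤ M * Real.exp (2 * b * τ) / 2 := by
    calc _ ≤ b * (M * Real.exp (2 * b * τ) / (2 * b)) := by gcongr
      _ = _ := by field_simp
  have h3 : y τ = M * Real.exp (2 * b * τ) := by
    rw [hM, mul_assoc, ← Real.exp_add]
    simp
  have h4 : M ≤ M * Real.exp (2 * b * τ) :=
    le_mul_of_one_le_right hMpos.le (Real.one_le_exp (by have := hτ.1; positivity))
  linarith

end Integral

/-! ### Local Lipschitz bounds for the nonlinearity and the density -/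

section Nonlinearity

variable {L : ℝ} [Fact (0 < 2 * L)]

theorem fourierCoeff_sub_cont (f g : C(Torus L, ℂ)) (l : ℤ) :
    fourierCoeff (f - g : C(Torus L, ℂ)) l = fourierCoeff f l - fourierCoeff g l := by
  rw [eq_sub_iff_add_eq, ← fourierCoeff_add_cont, sub_add_cancel]

theorem norm_fourierCoeff_le (f : C(Torus L, ℂ)) (l : ℤ) : ‖fourierCoeff f l‖ ≤ ‖f‖ := by
  unfold fourierCoeff
  refine (norm_integral_le_of_norm_le_const (C := ‖f‖) (Eventually.of_forall fun x => ?_)).trans ?_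
  · rw [norm_smul, fourier_apply, Circle.norm_coe, one_mul]
    exact f.norm_coe_le_norm x
  · simp

theorem continuous_fourierCoeff (l : ℤ) :
    Continuous fun f : C(Torus L, ℂ) => fourierCoeff f l := by
  refine LipschitzWith.continuous (K := 1) (LipschitzWith.of_dist_le_mul fun f g => ?_)
  rw [dist_eq_norm, dist_eq_norm, ← fourierCoeff_sub_cont, NNReal.coe_one, one_mul]
  exact norm_fourierCoeff_le _ _

/-- The product of two functions in `H¹`. -/
noncomputable def prodH1 (f g : Hs L 1) : Hs L 1 := ⟨f.1 * g.1, (exists_embed_mul_le f g).1⟩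

theorem norm_embed_prodH1_le (f g : Hs L 1) :
    ‖embed (prodH1 f g)‖ ≤ algebraConst L * ‖embed f‖ * ‖embed g‖ :=
  (exists_embed_mul_le f g).2

/-- The complex conjugate of a function in `H¹`. -/
noncomputable def conjH1 (f : Hs L 1) : Hs L 1 := ⟨star f.1, (exists_embed_star_le f).1⟩

theorem norm_embed_conjH1_le (f : Hs L 1) : ‖embed (conjH1 f)‖ ≤ ‖embed f‖ :=
  (exists_embed_star_le f).2

theorem norm_embed_prodH1_le_of_le {f g : Hs L 1} {a b : ℝ} (hf : ‖embed f‖ ≤ a)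
    (hg : ‖embed g‖ ≤ b) : ‖embed (prodH1 f g)‖ ≤ algebraConst L * a * b := by
  have := algebraConst_pos (L := L)
  have := (norm_nonneg _).trans hf
  exact (norm_embed_prodH1_le f g).trans (by gcongr)

theorem norm_embed_add_le_of_le {f g : Hs L 1} {a b : ℝ} (hf : ‖embed f‖ ≤ a)
    (hg : ‖embed g‖ ≤ b) : ‖embed (f + g)‖ ≤ a + b := by
  rw [map_add]
  exact norm_add_le_of_le hf hg

theorem density_sub_eq (f g : Hs L 1) :
    density f - density g = prodH1 f (conjH1 (f - g)) + prodH1 (f - g) (conjH1 g) := by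
  ext1
  change absSq f.1 - absSq g.1 = f.1 * star (f.1 - g.1) + (f.1 - g.1) * star g.1
  rw [absSq_eq, absSq_eq, star_sub]
  ring

theorem norm_embed_density_sub_le {f g : Hs L 1} {R : ℝ} (hf : ‖embed f‖ ≤ R)
    (hg : ‖embed g‖ ≤ R) :
    ‖embed (density f - density g)‖ ≤ 2 * algebraConst L * R * ‖embed (f - g)‖ := by
  rw [density_sub_eq]
  refine (norm_embed_add_le_of_le (norm_embed_prodH1_le_of_le hf (norm_embed_conjH1_le _))
    (norm_embed_prodH1_le_of_le le_rfl ((norm_embed_conjH1_le _).trans hg))).trans (le_of_eq ?_)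
  ring

/-- The right-hand side `W f + α |f|² f` of the equation. -/
noncomputable def nonlinearity (α : ℝ) (W : C(Torus L, ℝ)) (f : C(Torus L, ℂ)) : C(Torus L, ℂ) :=
  toComplex W * f + (α : ℂ) • (absSq f * f)

theorem continuous_nonlinearity (α : ℝ) (W : C(Torus L, ℝ)) :
    Continuous (nonlinearity α W) := by
  unfold nonlinearity
  simp only [absSq_eq]
  fun_prop

/-- The nonlinearity is locally Lipschitz in `H¹`, jointly in the potential and the function. -/
theorem nonlinearity_sub_bound (α : ℝ) {V W : C(Torus L, ℝ)} (hV : toComplex V ∈ Hs L 1)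
    (hW : toComplex W ∈ Hs L 1) {f g : Hs L 1} {R B : ℝ} (hB : ‖embed ⟨toComplex V, hV⟩‖ ≤ B)
    (hf : ‖embed f‖ ≤ R) (hg : ‖embed g‖ ≤ R) :
    ∃ h : nonlinearity α V f.1 - nonlinearity α W g.1 ∈ Hs L 1,
      ‖embed ⟨_, h⟩‖ ≤
        (algebraConst L * B + 3 * |α| * algebraConst L ^ 2 * R ^ 2) * ‖embed (f - g)‖ +
        algebraConst L * R * ‖embed (⟨toComplex V, hV⟩ - ⟨toComplex W, hW⟩)‖ := by
  set V' : Hs L 1 := ⟨toComplex V, hV⟩ with hV'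
  set W' : Hs L 1 := ⟨toComplex W, hW⟩ with hW'
  -- Telescoping: `Vf - Wg = V(f - g) + (V - W)g`, and `|f|²f - |g|²g = |f|²(f - g) + g(|f|² -
  -- |g|²)`. The last difference splits again into two products, so three cubic terms appear, whence
  -- the `3` in the bound.
  set X : Hs L 1 := prodH1 V' (f - g) + prodH1 (V' - W') g +
    (α : ℂ) • (prodH1 (prodH1 f (conjH1 f)) (f - g) +
      prodH1 g (prodH1 f (conjH1 (f - g)) + prodH1 (f - g) (conjH1 g))) with hX
  have e : X.1 = nonlinearity α V f.1 - nonlinearity α W g.1 := by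
    change toComplex V * (f.1 - g.1) + (toComplex V - toComplex W) * g.1 +
      (α : ℂ) • (f.1 * star f.1 * (f.1 - g.1) +
        g.1 * (f.1 * star (f.1 - g.1) + (f.1 - g.1) * star g.1)) = _
    unfold nonlinearity
    rw [absSq_eq, absSq_eq, star_sub]
    ext x
    simp only [ContinuousMap.add_apply, ContinuousMap.sub_apply, ContinuousMap.mul_apply,
      ContinuousMap.smul_apply, ContinuousMap.star_apply, smul_eq_mul]
    ring
  refine ⟨e ▸ X.2, ?_⟩
  have e' : (⟨_, e ▸ X.2⟩ : Hs L 1) = X := Subtype.ext e.symm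
  rw [e']
  have b1 := norm_embed_add_le_of_le
    (norm_embed_prodH1_le_of_le hB (le_refl ‖embed (f - g)‖))
    (norm_embed_prodH1_le_of_le (le_refl ‖embed (V' - W')‖) hg)
  have b2 := norm_embed_add_le_of_le
    (norm_embed_prodH1_le_of_le
      (norm_embed_prodH1_le_of_le hf ((norm_embed_conjH1_le f).trans hf))
      (le_refl ‖embed (f - g)‖))
    (norm_embed_prodH1_le_of_le hg (norm_embed_add_le_of_le
      (norm_embed_prodH1_le_of_le hf (norm_embed_conjH1_le (f - g)))
      (norm_embed_prodH1_le_of_le (le_refl ‖embed (f - g)‖) ((norm_embed_conjH1_le g).trans hg))))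
  have b3 : ∀ Y : Hs L 1, ‖embed ((α : ℂ) • Y)‖ = |α| * ‖embed Y‖ := fun Y => by
    rw [map_smul, norm_smul, Complex.norm_real, Real.norm_eq_abs]
  refine (norm_embed_add_le_of_le b1 ((b3 _).le.trans
    (mul_le_mul_of_nonneg_left b2 (abs_nonneg α)))).trans (le_of_eq ?_)
  ring

end Nonlinearity

/-! ### Lipschitz dependence of bounded solutions on the potential -/

section Solution

variable {L : ℝ} [Fact (0 < 2 * L)]

theorem continuousOn_val_of_continuousOn_embed {X : Type*} [TopologicalSpace X] {u : X → Hs L 1}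
    {s : Set X} (h : ContinuousOn (fun t => embed (u t)) s) :
    ContinuousOn (fun t => (u t).1) s := by
  intro t₀ ht₀
  have h1 := tendsto_iff_norm_sub_tendsto_zero.1 (h t₀ ht₀)
  refine tendsto_iff_norm_sub_tendsto_zero.2 ?_
  have h2 := h1.const_mul (embeddingConst L)
  rw [mul_zero] at h2
  refine squeeze_zero (fun _ => norm_nonneg _) (fun t => ?_) h2
  rw [← map_sub]
  exact norm_le_embed (u t - u t₀)

namespace IsMildSolution

variable {T α : ℝ} {V W : C(Torus L, ℝ)} {ψin : C(Torus L, ℂ)} {u w : ℝ → Hs L 1}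

theorem continuousOn_embed (hu : IsMildSolution T α V ψin u) :
    ContinuousOn (fun t => embed (u t)) (Set.Icc 0 T) := by
  intro t₀ ht₀
  refine tendsto_iff_norm_sub_tendsto_zero.2 ?_
  have h := (ENNReal.tendsto_toReal ENNReal.zero_ne_top).comp (hu.continuous_H1 t₀ ht₀)
  refine h.congr fun t => ?_
  have := sobolevNorm_one_eq (u t - u t₀)
  simp only [Function.comp_apply]
  rw [← map_sub, ← ENNReal.toReal_ofReal (norm_nonneg (embed (u t - u t₀))), ← this]
  rfl

theorem mono {T' : ℝ} (hu : IsMildSolution T α V ψin u) (h : T' ≤ T) :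
    IsMildSolution T' α V ψin u where
  continuous_H1 t₀ ht₀ :=
    (hu.continuous_H1 t₀ (Set.Icc_subset_Icc_right h ht₀)).mono_left
      (nhdsWithin_mono _ (Set.Icc_subset_Icc_right h))
  duhamel t ht := hu.duhamel t (Set.Icc_subset_Icc_right h ht)

theorem continuousOn_fourierCoeff_nonlinearity (hu : IsMildSolution T α V ψin u) (l : ℤ) :
    ContinuousOn (fun ρ => fourierCoeff (nonlinearity α V (u ρ).1) l) (Set.Icc 0 T) :=
  ((continuous_fourierCoeff l).comp (continuous_nonlinearity α V)).comp_continuousOn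
    (continuousOn_val_of_continuousOn_embed hu.continuousOn_embed)

/-- The initial data cancel in Duhamel's formula and the propagator has modulus one. Cauchy–Schwarz
in time puts the square under the integral, where it can be summed over the modes. -/
theorem norm_fourierCoeff_sub_sq_le (hu : IsMildSolution T α V ψin u)
    (hw : IsMildSolution T α W ψin w) {t : ℝ} (ht : t ∈ Set.Icc 0 T) (l : ℤ) :
    ‖fourierCoeff (u t - w t).1 l‖ ^ 2 ≤ t * ∫ ρ in (0 : ℝ)..t,
      ‖fourierCoeff (nonlinearity α V (u ρ).1 - nonlinearity α W (w ρ).1) l‖ ^ 2 := by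
  have hsub : Set.Icc 0 t ⊆ Set.Icc 0 T := Set.Icc_subset_Icc_right ht.2
  have cu := (hu.continuousOn_fourierCoeff_nonlinearity l).mono hsub
  have cw := (hw.continuousOn_fourierCoeff_nonlinearity l).mono hsub
  have ii : ∀ g : ℝ → ℂ, ContinuousOn g (Set.Icc 0 t) → IntervalIntegrable
      (fun ρ : ℝ => Complex.exp (-Complex.I * ((t - ρ) * freq L l ^ 2 / 2)) * g ρ)
      volume 0 t := by
    intro g hg
    apply ContinuousOn.intervalIntegrable
    rw [Set.uIcc_of_le ht.1]
    fun_prop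
  have key : ‖fourierCoeff (u t - w t).1 l‖ ≤ ∫ ρ in (0 : ℝ)..t,
      ‖fourierCoeff (nonlinearity α V (u ρ).1 - nonlinearity α W (w ρ).1) l‖ := by
    have e : fourierCoeff (u t - w t).1 l = -Complex.I * ∫ ρ in (0 : ℝ)..t,
        Complex.exp (-Complex.I * ((t - ρ) * freq L l ^ 2 / 2)) *
          fourierCoeff (nonlinearity α V (u ρ).1 - nonlinearity α W (w ρ).1) l := by
      simp only [fourierCoeff_sub_cont, mul_sub]
      rw [intervalIntegral.integral_sub (ii _ cu) (ii _ cw)]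
      change fourierCoeff ((u t).1 - (w t).1) l = _
      rw [fourierCoeff_sub_cont, hu.duhamel t ht l, hw.duhamel t ht l]
      simp only [nonlinearity]
      ring
    rw [e, norm_mul, norm_neg, Complex.norm_I, one_mul]
    refine (intervalIntegral.norm_integral_le_integral_norm ht.1).trans (le_of_eq ?_)
    refine intervalIntegral.integral_congr fun ρ _ => ?_
    have : -Complex.I * ((t - ρ) * freq L l ^ 2 / 2) =
        ((-((t - ρ) * freq L l ^ 2 / 2) : ℝ) : ℂ) * Complex.I := by push_cast; ring
    simp only [norm_mul]
    rw [this, Complex.norm_exp_ofReal_mul_I, one_mul]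
  refine (pow_le_pow_left₀ (norm_nonneg _) key 2).trans (sq_intervalIntegral_le ht.1 ?_)
  simp only [fourierCoeff_sub_cont]
  exact (cu.sub cw).norm

/-- Duhamel's formula bounds the difference of two solutions by that of the nonlinearities. -/
theorem norm_embed_sub_sq_le (hu : IsMildSolution T α V ψin u)
    (hw : IsMildSolution T α W ψin w) {t : ℝ} (ht : t ∈ Set.Icc 0 T) {g : ℝ → ℝ}
    (hg : ContinuousOn g (Set.Icc 0 t))
    (H : ∀ ρ ∈ Set.Icc 0 t, ∃ h : nonlinearity α V (u ρ).1 - nonlinearity α W (w ρ).1 ∈ Hs L 1,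
      ‖embed ⟨_, h⟩‖ ^ 2 ≤ g ρ) :
    ‖embed (u t - w t)‖ ^ 2 ≤ t * ∫ ρ in (0 : ℝ)..t, g ρ := by
  have hsub : Set.Icc 0 t ⊆ Set.Icc 0 T := Set.Icc_subset_Icc_right ht.2
  -- With finitely many modes, sum and time integral commute at once. The continuous majorant `g`
  -- spares any regularity in time of the `H¹` norm of the nonlinear difference.
  refine hasSum_le_of_sum_le (hasSum_norm_embed_sq (u t - w t)) fun F => ?_
  have ii : ∀ l : ℤ, IntervalIntegrable (fun ρ =>
      (1 + freq L l ^ 2) * ‖fourierCoeff (nonlinearity α V (u ρ).1 -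
        nonlinearity α W (w ρ).1) l‖ ^ 2) volume 0 t := by
    intro l
    apply ContinuousOn.intervalIntegrable
    rw [Set.uIcc_of_le ht.1]
    simp only [fourierCoeff_sub_cont]
    exact ((((hu.continuousOn_fourierCoeff_nonlinearity l).mono hsub).sub
      ((hw.continuousOn_fourierCoeff_nonlinearity l).mono hsub)).norm.pow 2).const_mul _
  calc ∑ l ∈ F, (1 + freq L l ^ 2) * ‖fourierCoeff (u t - w t).1 l‖ ^ 2
      ≤ ∑ l ∈ F, (1 + freq L l ^ 2) * (t * ∫ ρ in (0 : ℝ)..t,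
          ‖fourierCoeff (nonlinearity α V (u ρ).1 - nonlinearity α W (w ρ).1) l‖ ^ 2) := by
        gcongr with l
        exact hu.norm_fourierCoeff_sub_sq_le hw ht l
    _ = t * ∫ ρ in (0 : ℝ)..t, ∑ l ∈ F, (1 + freq L l ^ 2) *
          ‖fourierCoeff (nonlinearity α V (u ρ).1 - nonlinearity α W (w ρ).1) l‖ ^ 2 := by
        rw [intervalIntegral.integral_finsetSum fun l _ => ii l, Finset.mul_sum]
        refine Finset.sum_congr rfl fun l _ => ?_
        rw [intervalIntegral.integral_const_mul]
        ring
    _ ≤ t * ∫ ρ in (0 : ℝ)..t, g ρ := by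
        refine mul_le_mul_of_nonneg_left ?_ ht.1
        refine intervalIntegral.integral_mono_on ht.1
          (by simpa only [Finset.sum_fn] using IntervalIntegrable.sum F fun l _ => ii l)
          (ContinuousOn.intervalIntegrable (by rwa [Set.uIcc_of_le ht.1])) fun ρ hρ => ?_
        obtain ⟨h, hle⟩ := H ρ hρ
        exact (sum_le_hasSum F (fun l _ => by positivity) (hasSum_norm_embed_sq ⟨_, h⟩)).trans hle

/-- Solutions with bounded `H¹` norm depend Lipschitz continuously on the potential. -/
theorem norm_embed_sub_le (hu : IsMildSolution T α V ψin u) (hw : IsMildSolution T α W ψin w)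
    (hV : toComplex V ∈ Hs L 1) (hW : toComplex W ∈ Hs L 1) {R B κ : ℝ}
    (hB : ‖embed ⟨toComplex V, hV⟩‖ ≤ B)
    (huR : ∀ t ∈ Set.Icc 0 T, ‖embed (u t)‖ ≤ R) (hwR : ∀ t ∈ Set.Icc 0 T, ‖embed (w t)‖ ≤ R)
    (hκ : algebraConst L * B + 3 * |α| * algebraConst L ^ 2 * R ^ 2 ≤ κ)
    {t : ℝ} (ht : t ∈ Set.Icc 0 T) :
    ‖embed (u t - w t)‖ ≤ 2 * T * algebraConst L * R * Real.exp (2 * T ^ 2 * κ ^ 2 + T) *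
      ‖embed (⟨toComplex V, hV⟩ - ⟨toComplex W, hW⟩)‖ := by
  have hA := algebraConst_pos (L := L)
  have hR : 0 ≤ R := (norm_nonneg _).trans (huR t ht)
  have hT : 0 ≤ T := ht.1.trans ht.2
  set δ := ‖embed (⟨toComplex V, hV⟩ - ⟨toComplex W, hW⟩)‖ with hδ
  have cy : ContinuousOn (fun t => ‖embed (u t - w t)‖ ^ 2) (Set.Icc 0 T) := by
    simp only [map_sub]
    exact (hu.continuousOn_embed.sub hw.continuousOn_embed).norm.pow 2
  -- These constants come from squaring the Lipschitz bound with `(p + q)² ≤ 2p² + 2q²` and from `t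
  -- ≤ T`. The `+ 1` keeps `b` positive when `T` or `κ` vanishes, and produces the `+ T` in the
  -- exponent.
  have G := le_of_le_add_integral (b := 2 * T * κ ^ 2 + 1)
    (a := 2 * T ^ 2 * (algebraConst L * R * δ) ^ 2) (by positivity) cy (by positivity) ?_ t ht
  · refine le_of_sq_le_sq (G.trans ?_) (by positivity)
    have h1 : Real.exp (2 * (2 * T * κ ^ 2 + 1) * t) ≤ Real.exp (2 * T ^ 2 * κ ^ 2 + T) ^ 2 := by
      rw [← Real.exp_nat_mul]
      apply Real.exp_le_exp.2
      have : 0 ≤ T * κ ^ 2 * (T - t) := mul_nonneg (by positivity) (by linarith [ht.2])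
      push_cast
      nlinarith [ht.2]
    calc _ ≤ 2 * (2 * T ^ 2 * (algebraConst L * R * δ) ^ 2) *
          Real.exp (2 * T ^ 2 * κ ^ 2 + T) ^ 2 := by gcongr
      _ = _ := by ring
  · intro t ht
    have hsub : Set.Icc 0 t ⊆ Set.Icc 0 T := Set.Icc_subset_Icc_right ht.2
    have cy' : ContinuousOn (fun t => ‖embed (u t - w t)‖ ^ 2) (Set.uIcc 0 t) := by
      rw [Set.uIcc_of_le ht.1]
      exact cy.mono hsub
    have D := hu.norm_embed_sub_sq_le hw ht
      (g := fun ρ => 2 * κ ^ 2 * ‖embed (u ρ - w ρ)‖ ^ 2 + 2 * (algebraConst L * R * δ) ^ 2)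
      (((cy.mono hsub).const_mul _).add continuousOn_const) fun ρ hρ => ?_
    · rw [intervalIntegral.integral_add (cy'.intervalIntegrable.const_mul _)
        intervalIntegrable_const, intervalIntegral.integral_const_mul,
        intervalIntegral.integral_const, smul_eq_mul, sub_zero] at D
      have hI : 0 ≤ ∫ ρ in (0 : ℝ)..t, ‖embed (u ρ - w ρ)‖ ^ 2 :=
        intervalIntegral.integral_nonneg ht.1 fun ρ _ => by positivity
      have ht2 : t ^ 2 ≤ T ^ 2 := pow_le_pow_left₀ ht.1 ht.2 2
      refine D.trans ?_
      calc _ = 2 * t ^ 2 * (algebraConst L * R * δ) ^ 2 +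
            2 * t * κ ^ 2 * ∫ ρ in (0 : ℝ)..t, ‖embed (u ρ - w ρ)‖ ^ 2 := by ring
        _ ≤ _ := by
          have h := ht.2
          gcongr
          nlinarith [mul_le_mul_of_nonneg_right h (sq_nonneg κ)]
    · obtain ⟨h, hle⟩ := nonlinearity_sub_bound α hV hW hB (huR ρ (hsub hρ)) (hwR ρ (hsub hρ))
      refine ⟨h, (pow_le_pow_left₀ (norm_nonneg _) (hle.trans (add_le_add_left
        (mul_le_mul_of_nonneg_right hκ (norm_nonneg _)) _)) 2).trans ?_⟩
      nlinarith [sq_nonneg (κ * ‖embed (u ρ - w ρ)‖ - algebraConst L * R * δ)]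

end IsMildSolution

end Solution

/-! ### Uniform bounds by continuity and compactness -/

/-- A continuity argument: a bound that improves itself persists. -/
theorem le_one_of_self_improving {d : ℝ → ℝ} {T : ℝ} (hd : ContinuousOn d (Set.Icc 0 T))
    (h0 : d 0 ≤ 1)
    (H : ∀ t ∈ Set.Icc 0 T, (∀ ρ ∈ Set.Icc 0 t, d ρ ≤ 1) → d t ≤ 1 / 2) :
    ∀ t ∈ Set.Icc 0 T, d t ≤ 1 := by
  intro t ht
  by_contra! hlt
  have hsub : Set.Icc 0 t ⊆ Set.Icc 0 T := Set.Icc_subset_Icc_right ht.2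
  -- Look at the first time `τ` with `1 ≤ d τ`. By the intermediate value theorem `d τ = 1`, so `d ≤
  -- 1` on `[0, τ]`, and the improved bound `1 / 2` at `τ` is a contradiction.
  have hS : IsCompact (Set.Icc 0 t ∩ d ⁻¹' Set.Ici 1) :=
    isCompact_Icc.of_isClosed_subset
      ((hd.mono hsub).preimage_isClosed_of_isClosed isClosed_Icc isClosed_Ici)
      Set.inter_subset_left
  obtain ⟨τ, ⟨hτ, hτ1⟩, hleast⟩ := hS.exists_isLeast ⟨t, ⟨ht.1, le_rfl⟩, hlt.le⟩
  have hlow : ∀ ρ ∈ Set.Icc 0 t, 1 ≤ d ρ → τ ≤ ρ := fun ρ hρ h => hleast ⟨hρ, h⟩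
  have hτle : d τ ≤ 1 := by
    obtain ⟨σ, hσ, hσ1⟩ := intermediate_value_Icc hτ.1
      (hd.mono ((Set.Icc_subset_Icc_right hτ.2).trans hsub)) ⟨h0, hτ1⟩
    have := hlow σ ⟨hσ.1, hσ.2.trans hτ.2⟩ hσ1.ge
    rw [← hσ1, le_antisymm hσ.2 this]
  have := H τ (hsub hτ) fun ρ hρ => by
    rcases hρ.2.eq_or_lt with rfl | hlt'
    · exact hτle
    · by_contra! h
      exact (hlow ρ ⟨hρ.1, hρ.2.trans hτ.2⟩ h.le).not_gt hlt'
  have : (1 : ℝ) ≤ d τ := hτ1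
  linarith

section Dependence

variable {L : ℝ} [Fact (0 < 2 * L)]

theorem eq_zero_of_norm_embed_eq_zero {f : Hs L 1} (h : ‖embed f‖ = 0) : f = 0 := by
  have := norm_le_embed f
  rw [h, mul_zero] at this
  exact Subtype.ext (norm_le_zero_iff.1 this)

/-- The Lipschitz constant of the solution as a function of the potential, for solutions with
`H¹` norm at most `R` and potentials with `H¹` norm at most `B`. -/
noncomputable def lipschitzConst (L α T R B : ℝ) : ℝ :=
  2 * T * algebraConst L * R * Real.exp (2 * T ^ 2 *
    (algebraConst L * B + 3 * |α| * algebraConst L ^ 2 * R ^ 2) ^ 2 + T)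

theorem lipschitzConst_nonneg {L α T R B : ℝ} (hT : 0 ≤ T) (hR : 0 ≤ R) :
    0 ≤ lipschitzConst L α T R B := by
  have := algebraConst_pos (L := L)
  unfold lipschitzConst
  positivity

theorem lipschitzConst_mono {L α T T' R B : ℝ} (hT : 0 ≤ T) (hTT' : T ≤ T') (hR : 0 ≤ R) :
    lipschitzConst L α T R B ≤ lipschitzConst L α T' R B := by
  have := algebraConst_pos (L := L)
  have := hT.trans hTT'
  unfold lipschitzConst
  gcongr

namespace IsMildSolution

variable {T α : ℝ} {V W : C(Torus L, ℝ)} {ψin : C(Torus L, ℂ)} {u w : ℝ → Hs L 1} {P Q : Hs L 1}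

theorem norm_embed_sub_le_lipschitzConst (hu : IsMildSolution T α V ψin u)
    (hw : IsMildSolution T α W ψin w) (hP : P.1 = toComplex V) (hQ : Q.1 = toComplex W) {R B : ℝ}
    (hB : ‖embed P‖ ≤ B) (huR : ∀ t ∈ Set.Icc 0 T, ‖embed (u t)‖ ≤ R)
    (hwR : ∀ t ∈ Set.Icc 0 T, ‖embed (w t)‖ ≤ R) {t : ℝ} (ht : t ∈ Set.Icc 0 T) :
    ‖embed (u t - w t)‖ ≤ lipschitzConst L α T R B * ‖embed (P - Q)‖ := by
  obtain ⟨P, hPm⟩ := P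
  obtain ⟨Q, hQm⟩ := Q
  obtain rfl : P = toComplex V := hP
  obtain rfl : Q = toComplex W := hQ
  exact hu.norm_embed_sub_le hw hPm hQm hB huR hwR le_rfl ht

theorem exists_bound (hu : IsMildSolution T α V ψin u) :
    ∃ R, ∀ t ∈ Set.Icc 0 T, ‖embed (u t)‖ ≤ R :=
  isCompact_Icc.exists_bound_of_continuousOn hu.continuousOn_embed

/-- Uniqueness is the Lipschitz estimate for equal potentials. -/
theorem eq_of_mem_Icc (hu : IsMildSolution T α V ψin u) (hw : IsMildSolution T α V ψin w)
    (hP : P.1 = toComplex V) {t : ℝ} (ht : t ∈ Set.Icc 0 T) : u t = w t := by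
  obtain ⟨R₁, h₁⟩ := hu.exists_bound
  obtain ⟨R₂, h₂⟩ := hw.exists_bound
  have h := hu.norm_embed_sub_le_lipschitzConst hw hP hP le_rfl
    (fun t ht => (h₁ t ht).trans (le_max_left R₁ R₂))
    (fun t ht => (h₂ t ht).trans (le_max_right R₁ R₂)) ht
  rw [sub_self, map_zero, norm_zero, mul_zero] at h
  exact sub_eq_zero.1 (eq_zero_of_norm_embed_eq_zero (le_antisymm h (norm_nonneg _)))

theorem embed_sub_zero (hT : 0 ≤ T) (hu : IsMildSolution T α V ψin u)
    (hw : IsMildSolution T α W ψin w) : ‖embed (u 0 - w 0)‖ = 0 := by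
  have h := hasSum_norm_embed_sq (u 0 - w 0)
  have e : ∀ l : ℤ, ‖fourierCoeff (u 0 - w 0).1 l‖ ^ 2 = 0 := fun l => by
    have := hu.norm_fourierCoeff_sub_sq_le hw (Set.left_mem_Icc.2 hT) l
    rw [zero_mul] at this
    exact le_antisymm this (by positivity)
  simp only [e, mul_zero] at h
  exact pow_eq_zero_iff two_ne_zero |>.1 (h.unique hasSum_zero)

/-- Solutions for nearby potentials stay close on the whole time interval. -/
theorem norm_embed_sub_le_one (hu : IsMildSolution T α V ψin u)
    (hw : IsMildSolution T α W ψin w) (hP : P.1 = toComplex V) (hQ : Q.1 = toComplex W) {R : ℝ}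
    (huR : ∀ t ∈ Set.Icc 0 T, ‖embed (u t)‖ ≤ R)
    (hclose : lipschitzConst L α T (R + 1) ‖embed P‖ * ‖embed (P - Q)‖ ≤ 1 / 2) {t : ℝ}
    (ht : t ∈ Set.Icc 0 T) : ‖embed (u t - w t)‖ ≤ 1 := by
  have hT : 0 ≤ T := ht.1.trans ht.2
  have hR : 0 ≤ R := (norm_nonneg _).trans (huR t ht)
  have hd : ContinuousOn (fun t => ‖embed (u t - w t)‖) (Set.Icc 0 T) := by
    simp only [map_sub]
    exact (hu.continuousOn_embed.sub hw.continuousOn_embed).norm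
  refine le_one_of_self_improving hd ?_ (fun τ hτ h => ?_) t ht
  · rw [hu.embed_sub_zero hT hw]
    exact zero_le_one
  · have h1 : ∀ ρ ∈ Set.Icc 0 τ, ‖embed (u ρ)‖ ≤ R := fun ρ hρ =>
      huR ρ (Set.Icc_subset_Icc_right hτ.2 hρ)
    -- As long as the distance is at most `1`, the second solution is bounded by `R + 1`, so the
    -- Lipschitz estimate applies on `[0, τ]`; only there is this bound known.
    have h2 := (hu.mono hτ.2).norm_embed_sub_le_lipschitzConst (hw.mono hτ.2) hP hQ
      (R := R + 1) le_rfl (fun ρ hρ => (h1 ρ hρ).trans (by linarith))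
      (fun ρ hρ => by
        have e : embed (w ρ) = embed (u ρ) - embed (u ρ - w ρ) := by rw [map_sub]; abel
        rw [e]
        exact norm_sub_le_of_le (h1 ρ hρ) (h ρ hρ)) (Set.right_mem_Icc.2 hτ.1)
    refine h2.trans (le_trans ?_ hclose)
    exact mul_le_mul_of_nonneg_right (lipschitzConst_mono hτ.1 hτ.2 (by linarith))
      (norm_nonneg _)

end IsMildSolution

section Family

variable {X : Type*} [TopologicalSpace X] {K : Set X} {T α : ℝ} {W : X → C(Torus L, ℝ)}
  {ψin : C(Torus L, ℂ)} {P : X → Hs L 1} {u : X → ℝ → Hs L 1}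

/-- Solutions for a compact set of potentials are uniformly bounded in `H¹`. -/
theorem exists_uniform_bound (hK : IsCompact K)
    (hP : ∀ ξ ∈ K, (P ξ).1 = toComplex (W ξ)) (hPc : ContinuousOn (fun ξ => embed (P ξ)) K)
    (hu : ∀ ξ ∈ K, IsMildSolution T α (W ξ) ψin (u ξ)) :
    ∃ R, ∀ ξ ∈ K, ∀ t ∈ Set.Icc 0 T, ‖embed (u ξ t)‖ ≤ R := by
  suffices h : ∃ R, ∀ ξ ∈ K ∩ K, ∀ t ∈ Set.Icc 0 T, ‖embed (u ξ t)‖ ≤ R by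
    rwa [Set.inter_self] at h
  -- Being bounded over `s ∩ K` passes to subsets and finite unions of `s`, so a bound near each
  -- point of `K` is enough.
  refine hK.induction_on (p := fun s => ∃ R, ∀ ξ ∈ s ∩ K, ∀ t ∈ Set.Icc 0 T, ‖embed (u ξ t)‖ ≤ R)
    ⟨0, by simp⟩ ?_ ?_ ?_
  · rintro s s' hs ⟨R, hR⟩
    exact ⟨R, fun ξ hξ => hR ξ ⟨hs hξ.1, hξ.2⟩⟩
  · rintro s s' ⟨R, hR⟩ ⟨R', hR'⟩
    refine ⟨max R R', ?_⟩
    rintro ξ ⟨hξ | hξ, hξK⟩ t ht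
    · exact (hR ξ ⟨hξ, hξK⟩ t ht).trans (le_max_left _ _)
    · exact (hR' ξ ⟨hξ, hξK⟩ t ht).trans (le_max_right _ _)
  · intro ξ hξ
    obtain ⟨R, hR⟩ := (hu ξ hξ).exists_bound
    have lim : Tendsto (fun η => lipschitzConst L α T (R + 1) ‖embed (P ξ)‖ *
        ‖embed (P ξ - P η)‖) (𝓝[K] ξ) (𝓝 0) := by
      have h := (((hPc ξ hξ).const_sub (embed (P ξ))).norm).const_mul
        (lipschitzConst L α T (R + 1) ‖embed (P ξ)‖)
      simpa [map_sub] using h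
    refine ⟨_, lim.eventually (ge_mem_nhds (show (0 : ℝ) < 1 / 2 by norm_num)), R + 1, ?_⟩
    rintro η ⟨hη, hηK⟩ t ht
    have h := (hu ξ hξ).norm_embed_sub_le_one (hu η hηK) (hP ξ hξ) (hP η hηK) hR hη ht
    have e : embed (u η t) = embed (u ξ t) - embed (u ξ t - u η t) := by rw [map_sub]; abel
    rw [e]
    exact norm_sub_le_of_le (hR t ht) h

/-- Bounded functionals of the density depend Lipschitz continuously on the potential, if the
potential ranges over a compact set. -/
theorem exists_lipschitz_functional_density (hK : IsCompact K)
    (hP : ∀ ξ ∈ K, (P ξ).1 = toComplex (W ξ)) (hPc : ContinuousOn (fun ξ => embed (P ξ)) K)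
    (hu : ∀ ξ ∈ K, IsMildSolution T α (W ξ) ψin (u ξ)) {G : Hs L 1 →ₗ[ℂ] ℂ}
    (hG : IsBoundedOnH1 G) :
    ∃ C, 0 ≤ C ∧ ∀ t ∈ Set.Icc 0 T, ∀ ξ ∈ K, ∀ η ∈ K,
      ‖G (density (u ξ t)) - G (density (u η t))‖ ≤ C * ‖embed (P ξ - P η)‖ := by
  obtain ⟨c, hc⟩ := hG
  obtain ⟨R₀, hR₀⟩ := exists_uniform_bound hK hP hPc hu
  obtain ⟨B, hB⟩ := hK.exists_bound_of_continuousOn hPc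
  by_cases hT : 0 ≤ T
  swap
  · exact ⟨0, le_rfl, fun t ht => absurd (ht.1.trans ht.2) hT⟩
  -- `R₀` may be negative if `K` is empty.
  set R := max R₀ 0 with hRdef
  have hR : ∀ ξ ∈ K, ∀ t ∈ Set.Icc 0 T, ‖embed (u ξ t)‖ ≤ R := fun ξ hξ t ht =>
    (hR₀ ξ hξ t ht).trans (le_max_left _ _)
  have hR0 : 0 ≤ R := le_max_right _ _
  have hA := algebraConst_pos (L := L)
  have hG' : ∀ f : Hs L 1, ‖G f‖ ≤ c * ‖embed f‖ := fun f => by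
    have h := hc f
    rw [sobolevNorm_one_eq, ← ofReal_norm, ← ENNReal.ofReal_coe_nnreal,
      ← ENNReal.ofReal_mul c.coe_nonneg] at h
    exact (ENNReal.ofReal_le_ofReal_iff (by positivity)).1 h
  refine ⟨c * (2 * algebraConst L * R * lipschitzConst L α T R B),
    mul_nonneg c.2 (mul_nonneg (by positivity) (lipschitzConst_nonneg hT hR0)), ?_⟩
  intro t ht ξ hξ η hη
  have h1 := norm_embed_density_sub_le (hR ξ hξ t ht) (hR η hη t ht)
  have h2 := (hu ξ hξ).norm_embed_sub_le_lipschitzConst (hu η hη) (hP ξ hξ) (hP η hη) (hB ξ hξ)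
    (hR ξ hξ) (hR η hη) ht
  rw [← map_sub]
  calc _ ≤ c * ‖embed (density (u ξ t) - density (u η t))‖ := hG' _
    _ ≤ c * (2 * algebraConst L * R * (lipschitzConst L α T R B * ‖embed (P ξ - P η)‖)) := by
        gcongr
        exact h1.trans (by gcongr)
    _ = _ := by ring

end Family

end Dependence

/-! ### The parameter domain and its product law -/

section Law

theorem isCompact_paramDomain : IsCompact paramDomain := by
  have : paramDomain = Set.pi Set.univ fun _ : ℕ => Set.Icc (-1 / 2 : ℝ) (1 / 2) := by
    ext ξ
    simp only [Set.mem_univ_pi]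
    rfl
  rw [this]
  exact isCompact_univ_pi fun _ => isCompact_Icc

theorem paramDomainTrunc_eq (m : ℕ) :
    paramDomainTrunc m = Set.pi Set.univ fun _ : Fin m => Set.Icc (-1 / 2 : ℝ) (1 / 2) := by
  ext ξ
  simp only [Set.mem_univ_pi]
  rfl

theorem isCompact_paramDomainTrunc (m : ℕ) : IsCompact (paramDomainTrunc m) := by
  rw [paramDomainTrunc_eq]
  exact isCompact_univ_pi fun _ => isCompact_Icc

instance : IsProbabilityMeasure paramLaw := by
  unfold paramLaw
  infer_instance

theorem ae_mem_paramDomain : ∀ᵐ ξ ∂paramLaw, ξ ∈ paramDomain := by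
  refine ae_all_iff.2 fun j => ?_
  have h : ∀ᵐ x ∂uniformLaw, x ∈ Set.Icc (-1 / 2 : ℝ) (1 / 2) :=
    ae_restrict_mem measurableSet_Icc
  exact (measurePreserving_eval_infinitePi (fun _ : ℕ => uniformLaw) j).quasiMeasurePreserving.ae h

/-- The first `m` parameters. -/
def truncParam (m : ℕ) (ξ : ℕ → ℝ) : Fin m → ℝ := fun j => ξ j

/-- A box in `ℝ^m` pulls back to a cylinder, whose product measure is the product of the side
measures; boxes determine the product measure. -/
theorem measurePreserving_truncParam (m : ℕ) :
    MeasurePreserving (truncParam m) paramLaw (volume.restrict (paramDomainTrunc m)) := by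
  have hm : Measurable (truncParam m) := measurable_pi_lambda _ fun j => measurable_pi_apply _
  refine ⟨hm, ?_⟩
  rw [paramDomainTrunc_eq, volume_pi, Measure.restrict_pi_pi]
  symm
  refine Measure.pi_eq fun s hs => ?_
  rw [Measure.map_apply hm (MeasurableSet.univ_pi hs)]
  set t : ℕ → Set ℝ := fun j => if h : j < m then s ⟨j, h⟩ else Set.univ with ht
  have hts : ∀ j : Fin m, t j = s j := fun j => by simp [ht]
  have e : truncParam m ⁻¹' Set.univ.pi s = Set.pi (Finset.range m : Set ℕ) t := by
    ext ξ
    simp only [Set.mem_preimage, Set.mem_pi, Finset.coe_range, Set.mem_Iio]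
    constructor
    · intro h j hj
      have := h ⟨j, hj⟩ (Set.mem_univ _)
      rwa [← hts] at this
    · intro h j _
      rw [← hts]
      exact h j j.2
  rw [e, paramLaw, Measure.infinitePi_pi, Finset.prod_range]
  · refine Finset.prod_congr rfl fun j _ => ?_
    rw [hts]
    rfl
  · intro j hj
    have := hs ⟨j, Finset.mem_range.1 hj⟩
    rwa [← hts] at this

/-- The extension of finitely many parameters by zero. -/
noncomputable def extendParam (m : ℕ) (ζ : Fin m → ℝ) : ℕ → ℝ :=
  fun j => if h : j < m then ζ ⟨j, h⟩ else 0

theorem continuous_extendParam (m : ℕ) : Continuous (extendParam m) := by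
  refine continuous_pi fun j => ?_
  unfold extendParam
  split_ifs <;> fun_prop

theorem extendParam_mem {m : ℕ} {ζ : Fin m → ℝ} (hζ : ζ ∈ paramDomainTrunc m) :
    extendParam m ζ ∈ paramDomain := by
  intro j
  unfold extendParam
  split_ifs with h
  · exact hζ ⟨j, h⟩
  · norm_num

theorem truncParam_mem {m : ℕ} {ξ : ℕ → ℝ} (hξ : ξ ∈ paramDomain) :
    truncParam m ξ ∈ paramDomainTrunc m := fun j => hξ j

end Law

/-! ### Truncation as a choice of parameters; continuity of the potential -/

section ToComplex

variable {L : ℝ}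

theorem toComplex_add (V W : C(Torus L, ℝ)) : toComplex (V + W) = toComplex V + toComplex W := by
  ext x
  exact Complex.ofReal_add _ _

theorem toComplex_sub (V W : C(Torus L, ℝ)) : toComplex (V - W) = toComplex V - toComplex W := by
  ext x
  exact Complex.ofReal_sub _ _

theorem toComplex_smul (c : ℝ) (V : C(Torus L, ℝ)) :
    toComplex (c • V) = (c : ℂ) • toComplex V := by
  ext x
  exact Complex.ofReal_mul _ _

theorem toComplex_sum {ι : Type*} (s : Finset ι) (V : ι → C(Torus L, ℝ)) :
    toComplex (∑ j ∈ s, V j) = ∑ j ∈ s, toComplex (V j) := by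
  ext x
  change ((∑ j ∈ s, V j) x : ℂ) = (∑ j ∈ s, toComplex (V j)) x
  rw [ContinuousMap.sum_apply, ContinuousMap.sum_apply, Complex.ofReal_sum]
  rfl

/-- All terms from index `m` on vanish, so the series is a finite sum. One estimate on `U` thereby
serves every truncation. -/
theorem potential_extendParam {v₀ : C(Torus L, ℝ)} {lam : ℕ → ℝ} {v : ℕ → C(Torus L, ℝ)}
    (m : ℕ) (ζ : Fin m → ℝ) :
    potential v₀ lam v (extendParam m ζ) = potentialTrunc v₀ lam v m ζ := by
  unfold potential potentialTrunc
  rw [tsum_eq_sum (s := Finset.range m), Finset.sum_range]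
  · congr 1
    refine Finset.sum_congr rfl fun j _ => ?_
    simp [extendParam]
  · intro j hj
    have : ¬ j < m := fun h => hj (Finset.mem_range.2 h)
    simp [extendParam, this]

end ToComplex

section RandomPotential

variable {L : ℝ} [Fact (0 < 2 * L)]

theorem Hs_antitone {r s : ℝ} (h : r ≤ s) : Hs L s ≤ Hs L r := by
  intro f hf
  change sobolevNorm s f < ⊤ at hf
  change sobolevNorm r f < ⊤
  rw [sobolevNorm_lt_top_iff] at hf ⊢
  refine (ENNReal.tsum_le_tsum fun l => ?_).trans_lt hf
  gcongr
  nlinarith [sq_nonneg (freq L l)]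

variable {v₀ : C(Torus L, ℝ)} {lam : ℕ → ℝ} {v : ℕ → C(Torus L, ℝ)}

theorem BasicAssumption.toComplex_potential_mem {s : ℝ} {ψin : C(Torus L, ℂ)}
    {G : Hs L 1 →ₗ[ℂ] ℂ} (h : BasicAssumption s v₀ lam v ψin G) (hs : 1 ≤ s) {ξ : ℕ → ℝ}
    (hξ : ξ ∈ paramDomain) : toComplex (potential v₀ lam v ξ) ∈ Hs L 1 :=
  Hs_antitone hs ((le_iSup₂ (f := fun ξ (_ : ξ ∈ paramDomain) =>
    sobolevNorm s (toComplex (potential v₀ lam v ξ))) ξ hξ).trans_lt h.potential_bounded)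

/-- Every term of a finite sum is finite, and its factor `√λ_j` is positive, so it cannot hide an
infinite norm. -/
theorem DecayAssumption.toComplex_mem {χ : ℝ} (h : DecayAssumption χ v₀ lam v)
    (hlam : ∀ j, 0 < lam j) (j : ℕ) : toComplex (v j) ∈ Hs L 1 := by
  have h1 := ENNReal.ne_top_of_tsum_ne_top h.summable.ne j
  rw [ne_eq, ENNReal.rpow_eq_top_iff_of_pos (by norm_num)] at h1
  change sobolevNorm 1 (toComplex (v j)) < ⊤
  rw [lt_top_iff_ne_top]
  intro h2
  rw [h2] at h1
  refine h1 (ENNReal.mul_top ?_)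
  have := Real.sqrt_pos.2 (hlam j)
  simp only [ne_eq, ENNReal.ofReal_eq_zero, not_le]
  positivity

variable {P : (ℕ → ℝ) → Hs L 1}

theorem norm_embed_extendParam_sub_le {C χ : ℝ} (hC : 0 ≤ C) {m : ℕ}
    (hP : ∀ ξ ∈ paramDomain, (P ξ).1 = toComplex (potential v₀ lam v ξ))
    (h : supSobolevNorm 1 (fun ξ => potentialTruncFull v₀ lam v m ξ - potential v₀ lam v ξ) ≤
      ENNReal.ofReal (C * (m : ℝ) ^ (-χ))) {ξ : ℕ → ℝ} (hξ : ξ ∈ paramDomain) :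
    ‖embed (P (extendParam m (truncParam m ξ)) - P ξ)‖ ≤ C * (m : ℝ) ^ (-χ) := by
  have e : toComplex (potentialTruncFull v₀ lam v m ξ - potential v₀ lam v ξ) =
      (P (extendParam m (truncParam m ξ)) - P ξ).1 := by
    change _ = (P (extendParam m (truncParam m ξ))).1 - (P ξ).1
    rw [hP ξ hξ, hP _ (extendParam_mem (truncParam_mem hξ)), potential_extendParam, toComplex_sub]
    rfl
  have h1 := (le_iSup₂ (f := fun ξ (_ : ξ ∈ paramDomain) => sobolevNorm 1
    (toComplex (potentialTruncFull v₀ lam v m ξ - potential v₀ lam v ξ))) ξ hξ).trans h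
  rw [e, sobolevNorm_one_eq] at h1
  exact (ENNReal.ofReal_le_ofReal_iff (by positivity)).1 h1

/-- The potential is affine in finitely many parameters, with coefficients in `H¹`. -/
theorem continuousOn_embed_extendParam
    (hP : ∀ ξ ∈ paramDomain, (P ξ).1 = toComplex (potential v₀ lam v ξ))
    (hv : ∀ j, toComplex (v j) ∈ Hs L 1) (m : ℕ) :
    ContinuousOn (fun ζ => embed (P (extendParam m ζ))) (paramDomainTrunc m) := by
  have h0 : (0 : Fin m → ℝ) ∈ paramDomainTrunc m := fun j => by norm_num
  have key : ∀ ζ ∈ paramDomainTrunc m, P (extendParam m ζ) = P (extendParam m 0) +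
      ∑ j : Fin m, ((Real.sqrt (lam j) * ζ j : ℝ) : ℂ) • (⟨toComplex (v j), hv j⟩ : Hs L 1) := by
    intro ζ hζ
    ext1
    rw [hP _ (extendParam_mem hζ), Submodule.coe_add, hP _ (extendParam_mem h0),
      potential_extendParam, potential_extendParam, Submodule.coe_sum]
    simp only [potentialTrunc, toComplex_add, toComplex_sum, toComplex_smul, Submodule.coe_smul,
      Pi.zero_apply, mul_zero, zero_smul, Finset.sum_const_zero, add_zero]
  refine ContinuousOn.congr (f := fun ζ : Fin m → ℝ => embed (P (extendParam m 0)) +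
    ∑ j : Fin m, ((Real.sqrt (lam j) * ζ j : ℝ) : ℂ) •
      embed (⟨toComplex (v j), hv j⟩ : Hs L 1)) ?_ fun ζ hζ => ?_
  · fun_prop
  · simp only [key ζ hζ, map_add, map_sum, map_smul]

/-- The potential depends continuously on the parameters. -/
theorem DecayAssumption.continuousOn_embed {χ : ℝ} (h : DecayAssumption χ v₀ lam v) (hχ : 0 < χ)
    (hlam : ∀ j, 0 < lam j)
    (hP : ∀ ξ ∈ paramDomain, (P ξ).1 = toComplex (potential v₀ lam v ξ)) :
    ContinuousOn (fun ξ => embed (P ξ)) paramDomain := by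
  obtain ⟨C, hC, hrate⟩ := h.trunc_rate
  -- A uniform limit of functions of finitely many coordinates, hence continuous for the product
  -- topology, in which `U` is compact.
  have hunif : TendstoUniformlyOn (fun (m : ℕ) ξ => embed (P (extendParam m (truncParam m ξ))))
      (fun ξ => embed (P ξ)) atTop paramDomain := by
    rw [Metric.tendstoUniformlyOn_iff]
    intro ε hε
    have lim : Tendsto (fun m : ℕ => C * (m : ℝ) ^ (-χ)) atTop (𝓝 0) := by
      simpa using ((tendsto_rpow_neg_atTop hχ).comp tendsto_natCast_atTop_atTop).const_mul C
    filter_upwards [lim.eventually (gt_mem_nhds hε), eventually_gt_atTop 0] with m hm hm0 ξ hξ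
    rw [dist_comm, dist_eq_norm, ← map_sub]
    exact (norm_embed_extendParam_sub_le hC.le hP (hrate m hm0) hξ).trans_lt hm
  refine hunif.continuousOn (Frequently.of_forall fun m => ?_)
  refine (continuousOn_embed_extendParam hP (h.toComplex_mem hlam) m).comp
    (Continuous.continuousOn ?_) fun ξ hξ => truncParam_mem hξ
  exact continuous_pi fun j => continuous_apply _

end RandomPotential

/-! ### Integration and conclusion -/

theorem integrable_paramLaw_of_continuousOn {F : (ℕ → ℝ) → ℂ} (hF : ContinuousOn F paramDomain) :
    Integrable F paramLaw := by
  have h := hF.integrableOn_compact (μ := paramLaw) isCompact_paramDomain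
  rwa [IntegrableOn, Measure.restrict_eq_self_of_ae_mem ae_mem_paramDomain] at h

theorem mainTheorem8 (L : ℝ) [Fact (0 < 2 * L)] (T α s χ : ℝ)
    (hT : 0 < T) (hα : α ≠ 0) (hs : 1 ≤ s) (hχ : 0 < χ)
    (v₀ : C(Torus L, ℝ)) (lam : ℕ → ℝ) (v : ℕ → C(Torus L, ℝ))
    (hlam_anti : StrictAnti lam) (hlam_pos : ∀ j, 0 < lam j)
    (ψin : C(Torus L, ℂ)) (G : Hs L 1 →ₗ[ℂ] ℂ)
    (h₁ : BasicAssumption s v₀ lam v ψin G) (h₂ : DecayAssumption χ v₀ lam v)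
    (ψ : (ℕ → ℝ) → ℝ → Hs L 1)
    (hψ : ∀ ξ ∈ paramDomain, IsMildSolution T α (potential v₀ lam v ξ) ψin (ψ ξ))
    (ψm : (m : ℕ) → (Fin m → ℝ) → ℝ → Hs L 1)
    (hψm : ∀ m : ℕ, 0 < m → ∀ ξ ∈ paramDomainTrunc m,
      IsMildSolution T α (potentialTrunc v₀ lam v m ξ) ψin (ψm m ξ)) :
    ∃ C : ℝ, ∀ t ∈ Set.Icc 0 T,
      Integrable (fun ξ => G (density (ψ ξ t))) paramLaw ∧
      (∀ m : ℕ, 0 < m → IntegrableOn (fun ξ => G (density (ψm m ξ t))) (paramDomainTrunc m)) ∧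
      Tendsto (fun p : ℕ => ∫ ξ in paramDomainTrunc p, G (density (ψm p ξ t))) atTop
        (𝓝 (∫ ξ, G (density (ψ ξ t)) ∂paramLaw)) ∧
      ∀ m : ℕ, 0 < m →
        ‖(∫ ξ, G (density (ψ ξ t)) ∂paramLaw)
          - ∫ ξ in paramDomainTrunc m, G (density (ψm m ξ t))‖ ≤ C * (m : ℝ) ^ (-χ) := by
  choose! P' hP' using fun ξ (hξ : ξ ∈ paramDomain) =>
    (⟨⟨_, h₁.toComplex_potential_mem hs hξ⟩, rfl⟩ :
      ∃ p : Hs L 1, p.1 = toComplex (potential v₀ lam v ξ))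
  have hcont := h₂.continuousOn_embed hχ hlam_pos hP'
  obtain ⟨C, hC, hLip⟩ := exists_lipschitz_functional_density isCompact_paramDomain hP' hcont hψ
    h₁.functional_bounded
  obtain ⟨C₀, hC₀, hrate⟩ := h₂.trunc_rate
  refine ⟨C * C₀, fun t ht => ?_⟩
  have hG : ContinuousOn (fun ξ => G (density (ψ ξ t))) paramDomain := by
    intro ξ hξ
    refine tendsto_iff_norm_sub_tendsto_zero.2 ?_
    have lim := (tendsto_iff_norm_sub_tendsto_zero.1 (hcont ξ hξ)).const_mul C
    rw [mul_zero] at lim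
    refine squeeze_zero' (Eventually.of_forall fun _ => norm_nonneg _) ?_ lim
    filter_upwards [self_mem_nhdsWithin] with η hη
    rw [← map_sub embed]
    exact hLip t ht η hη ξ hξ
  have hint := integrable_paramLaw_of_continuousOn hG
  -- Both sides solve the equation with the same potential.
  have hψm_eq : ∀ m : ℕ, 0 < m → ∀ ζ ∈ paramDomainTrunc m,
      ψm m ζ t = ψ (extendParam m ζ) t := by
    intro m hm ζ hζ
    have hext := extendParam_mem hζ
    have h := hψ _ hext
    have hp := hP' _ hext
    rw [potential_extendParam] at h hp
    exact (hψm m hm ζ hζ).eq_of_mem_Icc h hp ht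
  have hGm : ∀ m : ℕ, 0 < m →
      IntegrableOn (fun ζ => G (density (ψm m ζ t))) (paramDomainTrunc m) := by
    intro m hm
    refine ContinuousOn.integrableOn_compact (isCompact_paramDomainTrunc m) ?_
    refine (hG.comp (continuous_extendParam m).continuousOn fun ζ hζ => extendParam_mem hζ).congr
      fun ζ hζ => ?_
    simp only [Function.comp_apply, hψm_eq m hm ζ hζ]
  have hbound : ∀ m : ℕ, 0 < m → ‖(∫ ξ, G (density (ψ ξ t)) ∂paramLaw) -
      ∫ ξ in paramDomainTrunc m, G (density (ψm m ξ t))‖ ≤ C * C₀ * (m : ℝ) ^ (-χ) := by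
    intro m hm
    have mp := measurePreserving_truncParam m
    -- Moving the integral to `U` puts both expectations under one probability measure, so a
    -- pointwise bound suffices.
    have hmap : ∫ ξ in paramDomainTrunc m, G (density (ψm m ξ t)) =
        ∫ ξ, G (density (ψm m (truncParam m ξ) t)) ∂paramLaw := by
      rw [← mp.map_eq, integral_map mp.measurable.aemeasurable]
      rw [mp.map_eq]
      exact (hGm m hm).aestronglyMeasurable
    have hint' : Integrable (fun ξ => G (density (ψm m (truncParam m ξ) t))) paramLaw :=
      mp.integrable_comp_of_integrable (hGm m hm)
    rw [hmap, ← integral_sub hint hint']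
    refine (norm_integral_le_of_norm_le_const (C := C * C₀ * (m : ℝ) ^ (-χ)) ?_).trans ?_
    · filter_upwards [ae_mem_paramDomain] with ξ hξ
      have hmem := extendParam_mem (truncParam_mem (m := m) hξ)
      rw [hψm_eq m hm _ (truncParam_mem hξ), norm_sub_rev, mul_assoc]
      exact (hLip t ht _ hmem ξ hξ).trans (mul_le_mul_of_nonneg_left
        (norm_embed_extendParam_sub_le hC₀.le hP' (hrate m hm) hξ) hC)
    · simp
  refine ⟨hint, hGm, ?_, hbound⟩
  refine tendsto_iff_norm_sub_tendsto_zero.2 ?_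
  have lim : Tendsto (fun m : ℕ => C * C₀ * (m : ℝ) ^ (-χ)) atTop (𝓝 0) := by
    simpa using ((tendsto_rpow_neg_atTop hχ).comp tendsto_natCast_atTop_atTop).const_mul (C * C₀)
  refine squeeze_zero' (Eventually.of_forall fun _ => norm_nonneg _) ?_ lim
  filter_upwards [eventually_gt_atTop 0] with m hm
  rw [norm_sub_rev]
  exact hbound m hm
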